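/- Let $\tau(y)=1$ for $y<0$ and $\tau(y)=2$ for $y\ge 0$, and let $w_0\in C_c^\infty(\mathbb R)$ be real-valued. For $\varepsilon>0$ let $y^j=2j\varepsilon$ for integers $j<0$ and $y^j=j\varepsilon$ for integers $j\ge0$, and define $w_\ell^j$ ($\ell\in\mathbb Z_{\ge0}$, $j\in\mathbb Z$) by $$w_0^j=\frac1{y^{j+1}-y^j}\int_{y^j}^{y^{j+1}}w_0(x)\,dx$$ and, for $\ell\ge1$, $$w_\ell^j=\begin{cases}\tfrac14w_{\ell-1}^{j-1}+\tfrac12w_{\ell-1}^{j}+\tfrac14w_{\ell-1}^{j+1}, & j<0,\\ \tfrac14w_{\ell-1}^{-1}+\tfrac14w_{\ell-1}^{0}+\tfrac12w_{\ell-1}^{1}, & j=0,\\ \tfrac12w_{\ell-1}^{j-1}+\tfrac12w_{\ell-1}^{j+1}, & j>0.\end{cases}$$ Let $w^\varepsilon$ be the bilinear interpolation on $[0,\infty)\times\mathbb R$: for $2\ell\varepsilon^2\le t<2(\ell+1)\varepsilon^2$ and $y^j\le y<y^{j+1}$, with $\lambda=\frac{t-2\ell\varepsilon^2}{2\varepsilon^2}$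 and $\nu=\frac{y-y^j}{y^{j+1}-y^j}$, $$w^\varepsilon(t,y)=\lambda\nu\,w_{\ell+1}^{j+1}+\lambda(1-\nu)\,w_{\ell+1}^{j}+(1-\lambda)\nu\,w_\ell^{j+1}+(1-\lambda)(1-\nu)\,w_\ell^{j}.$$ Then every sequence of positive numbers tending to $0$ has a subsequence $(\varepsilon_i)$ for which there is a Lipschitz continuous function $w$ on $[0,\infty)\times\mathbb R$ such that $w^{\varepsilon_i}\to w$ uniformly on every compact $K\subset[0,\infty)\times\mathbb R$ and $\partial_yw^{\varepsilon_i}\rightharpoonup\partial_yw$ weakly$^*$ in $L^\infty((0,\infty)\times\mathbb R)$ ($\partial_y$ being the weak derivative). Moreover $w(0,\cdot)=w_0$ and $w$ is a weak solution of $$\tau(y)\,w_t=\tfrac12w_{yy},\qquad w(0,\cdot)=w_0,$$ that is, $w$ and $w_y$ belong to $L^1_{loc}([0,\infty)\times\mathbb R)$ and for all $\phi\in C_c^1([0,\infty)\times\mathbb R)$ $$\int_0^\infty\!\!\int_{\mathbb R}\tau w\,\phi_t\,dy\,dt+\int_{\mathbb R}\tau w_0\,\phi(0,y)\,dy=\frac12\int_0^\infty\!\!\int_{\mathbb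 R}w_y\,\phi_y\,dy\,dt.$$ Consequently $v(t,x)=\tau(x)w(t,x)$ is a weak solution of $v_t=\frac12\left(\frac v\tau\right)_{xx}$ with $v(0,\cdot)=v_0:=\tau w_0$: $v$ and $(v/\tau)_x$ belong to $L^1_{loc}([0,\infty)\times\mathbb R)$ and for all $\phi\in C_c^1([0,\infty)\times\mathbb R)$ $$\int_0^\infty\!\!\int_{\mathbb R}v\,\phi_t\,dx\,dt+\int_{\mathbb R}v_0\,\phi(0,x)\,dx=\frac12\int_0^\infty\!\!\int_{\mathbb R}\Big(\frac v\tau\Big)_x\phi_x\,dx\,dt.$$ -/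

import Mathlib

open Set Filter Topology MeasureTheory

namespace SojournWalk

noncomputable section

/-- The step sojourn time: `1` on the left half-line, `2` on the right half-line. -/
def tau (x : ℝ) : ℝ := if x < 0 then 1 else 2

/-- The nonuniform grid points `y^j`: spacing `2ε` on the left of the origin, `ε` on the right. -/
def gridPt (ε : ℝ) (j : ℤ) : ℝ := if j < 0 then 2 * j * ε else j * ε

/-- The times `t_{2ℓ} = 2ℓε²`. -/
def gridTime (ε : ℝ) (l : ℕ) : ℝ := 2 * l * ε ^ 2

/-- The discrete values `w_ℓ^j`: they start from the cell averages of `w₀` on `(y^j, y^{j+1})`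
and evolve by the Markovian reduced random walk. -/
def walk (w₀ : ℝ → ℝ) (ε : ℝ) : ℕ → ℤ → ℝ
  | 0, j => (gridPt ε (j + 1) - gridPt ε j)⁻¹ * ∫ x in (gridPt ε j)..(gridPt ε (j + 1)), w₀ x
  | l + 1, j =>
    if j < 0 then
      1 / 4 * walk w₀ ε l (j - 1) + 1 / 2 * walk w₀ ε l j + 1 / 4 * walk w₀ ε l (j + 1)
    else if j = 0 then
      1 / 4 * walk w₀ ε l (-1) + 1 / 4 * walk w₀ ε l 0 + 1 / 2 * walk w₀ ε l 1
    else
      1 / 2 * walk w₀ ε l (j - 1) + 1 / 2 * walk w₀ ε l (j + 1)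

/-- The index `j` of the cell `[y^j, y^{j+1})` that contains `y`. -/
def spaceIdx (ε y : ℝ) : ℤ := if y < 0 then ⌊y / (2 * ε)⌋ else ⌊y / ε⌋

/-- The index `ℓ` of the time interval `[t_{2ℓ}, t_{2ℓ+2})` that contains `t ≥ 0`. -/
def timeIdx (ε t : ℝ) : ℕ := ⌊t / (2 * ε ^ 2)⌋₊

theorem mem_space_cell {ε : ℝ} (hε : 0 < ε) (y : ℝ) :
    y ∈ Ico (gridPt ε (spaceIdx ε y)) (gridPt ε (spaceIdx ε y + 1)) := by
  have h2 : (0 : ℝ) < 2 * ε := by positivity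
  unfold spaceIdx
  split_ifs with hy
  · have hneg : ⌊y / (2 * ε)⌋ < 0 := by
      rw [Int.floor_lt]; simpa using div_neg_of_neg_of_pos hy h2
    have ha := (le_div_iff₀ h2).1 (Int.floor_le (y / (2 * ε)))
    have hb := (div_lt_iff₀ h2).1 (Int.lt_floor_add_one (y / (2 * ε)))
    have hl : gridPt ε ⌊y / (2 * ε)⌋ = 2 * ⌊y / (2 * ε)⌋ * ε := by simp [gridPt, hneg]
    have hr : gridPt ε (⌊y / (2 * ε)⌋ + 1) = 2 * (⌊y / (2 * ε)⌋ + 1) * ε := by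
      rcases (show ⌊y / (2 * ε)⌋ + 1 ≤ 0 by omega).lt_or_eq with h | h
      · simp [gridPt, h]
      · have h' : (⌊y / (2 * ε)⌋ : ℝ) + 1 = 0 := by exact_mod_cast h
        simp [gridPt, h, h']
    rw [hl, hr]
    exact ⟨by linarith, by linarith⟩
  · have hnn : 0 ≤ ⌊y / ε⌋ := Int.floor_nonneg.2 (div_nonneg (not_lt.1 hy) hε.le)
    have ha := (le_div_iff₀ hε).1 (Int.floor_le (y / ε))
    have hb := (div_lt_iff₀ hε).1 (Int.lt_floor_add_one (y / ε))
    have hl : gridPt ε ⌊y / ε⌋ = ⌊y / ε⌋ * ε := by simp [gridPt, hnn]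
    have hr : gridPt ε (⌊y / ε⌋ + 1) = (⌊y / ε⌋ + 1) * ε := by
      simp [gridPt, not_lt.2 (show 0 ≤ ⌊y / ε⌋ + 1 by omega)]
    rw [hl, hr]
    exact ⟨ha, hb⟩

theorem mem_time_cell {ε t : ℝ} (hε : 0 < ε) (ht : 0 ≤ t) :
    t ∈ Ico (gridTime ε (timeIdx ε t)) (gridTime ε (timeIdx ε t + 1)) := by
  have h2 : (0 : ℝ) < 2 * ε ^ 2 := by positivity
  have ha := (le_div_iff₀ h2).1 (Nat.floor_le (div_nonneg ht h2.le))
  have hb := (div_lt_iff₀ h2).1 (Nat.lt_floor_add_one (t / (2 * ε ^ 2)))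
  unfold gridTime timeIdx
  push_cast
  exact ⟨by linarith, by linarith⟩

/-- The bilinear interpolation `w^ε(t,y)`, `p = (t, y)`, on `[0,∞) × ℝ`
(values at negative times are irrelevant). -/
def interp (w₀ : ℝ → ℝ) (ε : ℝ) (p : ℝ × ℝ) : ℝ :=
  let l := timeIdx ε p.1
  let j := spaceIdx ε p.2
  let lam := (p.1 - gridTime ε l) / (gridTime ε (l + 1) - gridTime ε l)
  let nu := (p.2 - gridPt ε j) / (gridPt ε (j + 1) - gridPt ε j)
  lam * nu * walk w₀ ε (l + 1) (j + 1) + lam * (1 - nu) * walk w₀ ε (l + 1) j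
    + (1 - lam) * nu * walk w₀ ε l (j + 1) + (1 - lam) * (1 - nu) * walk w₀ ε l j

/-- The open half-plane `(0,∞) × ℝ` of points `(t, y)`. -/
def openHalf : Set (ℝ × ℝ) := Ioi 0 ×ˢ univ

/-- The closed half-plane `[0,∞) × ℝ` of points `(t, y)`. -/
def closedHalf : Set (ℝ × ℝ) := Ici 0 ×ˢ univ

/-- `g` is the weak (distributional) derivative `∂_y f` on `(0,∞) × ℝ`. -/
def HasWeakDerivY (f g : ℝ × ℝ → ℝ) : Prop :=
  LocallyIntegrableOn f openHalf ∧ LocallyIntegrableOn g openHalf ∧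
  ∀ φ : ℝ × ℝ → ℝ, ContDiff ℝ (⊤ : ℕ∞) φ → HasCompactSupport φ → tsupport φ ⊆ openHalf →
    ∫ p in openHalf, f p * deriv (fun y => φ (p.1, y)) p.2 = -∫ p in openHalf, g p * φ p

/-- Weak* convergence in `L^∞((0,∞) × ℝ)`, as the dual of `L¹((0,∞) × ℝ)`. -/
def TendstoWeakStar (g : ℕ → ℝ × ℝ → ℝ) (G : ℝ × ℝ → ℝ) : Prop :=
  (∀ i, MemLp (g i) ⊤ (volume.restrict openHalf)) ∧ MemLp G ⊤ (volume.restrict openHalf) ∧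
  ∀ h : ℝ × ℝ → ℝ, Integrable h (volume.restrict openHalf) →
    Tendsto (fun i => ∫ p in openHalf, g i p * h p) atTop (𝓝 (∫ p in openHalf, G p * h p))

/-- `∂_y f_i ⇀ ∂_y f` weakly* in `L^∞((0,∞) × ℝ)`, with weak derivatives
(which are unique almost everywhere). -/
def DerivYTendstoWeakStar (f : ℕ → ℝ × ℝ → ℝ) (F : ℝ × ℝ → ℝ) : Prop :=
  ∃ (g : ℕ → ℝ × ℝ → ℝ) (G : ℝ × ℝ → ℝ),
    (∀ i, HasWeakDerivY (f i) (g i)) ∧ HasWeakDerivY F G ∧ TendstoWeakStar g G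

/-- `w` is a weak solution of `τ(y) w_t = ½ w_yy`, `w(0,·) = w₀`: both `w` and its weak derivative
`w_y` are in `L¹_loc([0,∞) × ℝ)`, and the integral identity holds for all
`φ ∈ C_c¹([0,∞) × ℝ)`, i.e. for the restrictions of compactly supported `C¹` functions of the
plane to the closed half-plane. -/
def IsWeakSolution (w₀ : ℝ → ℝ) (w : ℝ × ℝ → ℝ) : Prop :=
  LocallyIntegrableOn w closedHalf ∧
  ∃ wy : ℝ × ℝ → ℝ, HasWeakDerivY w wy ∧ LocallyIntegrableOn wy closedHalf ∧
    ∀ φ : ℝ × ℝ → ℝ, ContDiff ℝ 1 φ → HasCompactSupport φ →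
      (∫ p in openHalf, tau p.2 * w p * deriv (fun t => φ (t, p.2)) p.1)
          + ∫ y, tau y * w₀ y * φ (0, y)
        = 1 / 2 * ∫ p in openHalf, wy p * deriv (fun y => φ (p.1, y)) p.2

/-- `v` is a weak solution of `v_t = ½ (v/τ)_xx`, `v(0,·) = v₀`. -/
def IsWeakDensitySolution (v₀ : ℝ → ℝ) (v : ℝ × ℝ → ℝ) : Prop :=
  LocallyIntegrableOn v closedHalf ∧
  ∃ z : ℝ × ℝ → ℝ, HasWeakDerivY (fun p => v p / tau p.2) z ∧ LocallyIntegrableOn z closedHalf ∧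
    ∀ φ : ℝ × ℝ → ℝ, ContDiff ℝ 1 φ → HasCompactSupport φ →
      (∫ p in openHalf, v p * deriv (fun t => φ (t, p.2)) p.1) + ∫ x, v₀ x * φ (0, x)
        = 1 / 2 * ∫ p in openHalf, z p * deriv (fun x => φ (p.1, x)) p.2

end

end SojournWalk

namespace SojournWalk

noncomputable section

/-! Each step of the scheme is linear and replaces a value by a convex combination of nearby ones,
so sup bounds and sup distances between grid functions never grow. It is also conservative: τ times
the cell width equals 2ε on every cell, and the increment of a value is ε/2 times a jump of slopes
(`step_sub_self`).

Compactness comes from bounds uniform in ε. In space, the slopes are themselves averaged by the step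
(`abs_step_gap_le`). In time, the slope bound only gives O(ε) per step, which is useless over ε⁻²
steps. However, w₀ sampled at the nodes changes by O(ε²) in one step, because the walk has mean
displacement zero even at the interface (`abs_step_nodal_sub_le`); linearity and contraction carry
this bound to every later step. Starting from cell averages instead costs O(ε), uniformly in time.
So the interpolations are Lipschitz up to a vanishing error (`abs_interp_sub_interp_le`), and an
Arzelà–Ascoli argument gives the limit w.

The y-derivatives are bounded, so their weak* convergence follows from integration by parts against
smooth functions and density in L¹. For the equation, shifting the interpolation by one time step is
exactly one application of `step`. Summation by parts in space and a shift in time then give an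
identity without error terms (`half_integral_interpDerivY_mul`): a difference quotient falls on φ,
and a layer of thickness 2ε² produces the initial datum. Dominated convergence finishes the proof.
-/

/-! ### The nonuniform grid and the weight τ. -/

/-- The width `y^{j+1} - y^j` of the `j`-th cell. -/
def cellWidth (ε : ℝ) (j : ℤ) : ℝ := if j < 0 then 2 * ε else ε

theorem gridPt_add_one (ε : ℝ) (j : ℤ) : gridPt ε (j + 1) = gridPt ε j + cellWidth ε j := by
  unfold gridPt cellWidth
  rcases lt_trichotomy (j + 1) 0 with h | h | h
  · rw [if_pos h, if_pos (by omega), if_pos (by omega)]; push_cast; ring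
  · obtain rfl : j = -1 := by omega
    norm_num
  · rw [if_neg (by omega), if_neg (by omega), if_neg (by omega)]; push_cast; ring

theorem gridPt_add_one_sub (ε : ℝ) (j : ℤ) : gridPt ε (j + 1) - gridPt ε j = cellWidth ε j := by
  rw [gridPt_add_one]; ring

theorem cellWidth_pos {ε : ℝ} (hε : 0 < ε) (j : ℤ) : 0 < cellWidth ε j := by
  unfold cellWidth; split_ifs <;> linarith

theorem cellWidth_le {ε : ℝ} (hε : 0 < ε) (j : ℤ) : cellWidth ε j ≤ 2 * ε := by
  unfold cellWidth; split_ifs <;> linarith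

theorem cellWidth_add_one_le {ε : ℝ} (hε : 0 < ε) (j : ℤ) :
    cellWidth ε (j + 1) ≤ cellWidth ε j := by
  unfold cellWidth; split_ifs <;> linarith

theorem gridPt_strictMono {ε : ℝ} (hε : 0 < ε) : StrictMono (gridPt ε) := by
  apply strictMono_int_of_lt_succ
  intro j
  rw [gridPt_add_one]
  linarith [cellWidth_pos hε j]

theorem spaceIdx_eq_iff {ε : ℝ} (hε : 0 < ε) (y : ℝ) (j : ℤ) :
    spaceIdx ε y = j ↔ y ∈ Ico (gridPt ε j) (gridPt ε (j + 1)) := by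
  have h := mem_space_cell hε y
  refine ⟨fun e => e ▸ h, fun h' => ?_⟩
  have h1 := (gridPt_strictMono hε).lt_iff_lt.1 (h.1.trans_lt h'.2)
  have h2 := (gridPt_strictMono hε).lt_iff_lt.1 (h'.1.trans_lt h.2)
  omega

theorem gridPt_neg_iff {ε : ℝ} (hε : 0 < ε) (j : ℤ) : gridPt ε j < 0 ↔ j < 0 := by
  have h0 : gridPt ε 0 = 0 := by simp [gridPt]
  rw [← h0, (gridPt_strictMono hε).lt_iff_lt]

theorem tau_eq_of_mem_cell {ε y : ℝ} (hε : 0 < ε) {j : ℤ}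
    (hy : y ∈ Ico (gridPt ε j) (gridPt ε (j + 1))) : tau y = if j < 0 then 1 else 2 := by
  unfold tau
  by_cases hj : j < 0
  · have h : gridPt ε (j + 1) ≤ 0 := by
      by_contra h
      have h0 : gridPt ε 0 = 0 := by simp [gridPt]
      rw [← h0, (gridPt_strictMono hε).le_iff_le] at h
      omega
    rw [if_pos (hy.2.trans_le h), if_pos hj]
  · have := hy.1
    rw [if_neg, if_neg hj]
    have := mt (gridPt_neg_iff hε j).1 hj
    linarith

theorem abs_tau_le (y : ℝ) : |tau y| ≤ 2 := by
  unfold tau; split_ifs <;> norm_num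

theorem tau_ne_zero (y : ℝ) : tau y ≠ 0 := by
  unfold tau; split_ifs <;> norm_num

/-! ### Maximum principle, slope bound and conservative form of one step. -/

/-- One step of the Markovian reduced random walk. -/
def step (a : ℤ → ℝ) (j : ℤ) : ℝ :=
  if j < 0 then 1 / 4 * a (j - 1) + 1 / 2 * a j + 1 / 4 * a (j + 1)
  else if j = 0 then 1 / 4 * a (-1) + 1 / 4 * a 0 + 1 / 2 * a 1
  else 1 / 2 * a (j - 1) + 1 / 2 * a (j + 1)

theorem walk_succ (w₀ : ℝ → ℝ) (ε : ℝ) (l : ℕ) : walk w₀ ε (l + 1) = step (walk w₀ ε l) := by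
  funext j
  rw [walk, step]

theorem walk_eq_iterate (w₀ : ℝ → ℝ) (ε : ℝ) (l : ℕ) : walk w₀ ε l = step^[l] (walk w₀ ε 0) := by
  induction l with
  | zero => rfl
  | succ l ih => rw [walk_succ, ih, Function.iterate_succ_apply']

theorem step_sub (a b : ℤ → ℝ) : step (a - b) = step a - step b := by
  funext j
  simp only [step, Pi.sub_apply]
  split_ifs <;> ring

theorem iterate_step_sub (a b : ℤ → ℝ) (l : ℕ) : step^[l] (a - b) = step^[l] a - step^[l] b := by
  induction l with
  | zero => rfl
  | succ l ih => simp only [Function.iterate_succ_apply', ih, step_sub]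

theorem abs_step_le {a : ℤ → ℝ} {M : ℝ} (ha : ∀ j, |a j| ≤ M) (j : ℤ) : |step a j| ≤ M := by
  have h1 := fun j => abs_le.1 (ha j)
  have h2 := h1 (j - 1); have h3 := h1 j; have h4 := h1 (j + 1)
  have h5 := h1 (-1); have h6 := h1 0; have h7 := h1 1
  unfold step
  rw [abs_le]
  split_ifs <;> constructor <;> linarith

theorem abs_iterate_step_le {a : ℤ → ℝ} {M : ℝ} (ha : ∀ j, |a j| ≤ M) (l : ℕ) (j : ℤ) :
    |step^[l] a j| ≤ M := by
  induction l generalizing j with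
  | zero => exact ha j
  | succ l ih => rw [Function.iterate_succ_apply']; exact abs_step_le ih j

theorem abs_iterate_step_sub_le {a b : ℤ → ℝ} {M : ℝ} (h : ∀ j, |a j - b j| ≤ M) (l : ℕ) (j : ℤ) :
    |step^[l] a j - step^[l] b j| ≤ M := by
  have := abs_iterate_step_le (a := a - b) h l j
  rwa [iterate_step_sub] at this

/-- Slopes obey an averaging rule too: the new slope has weights 1/4, 1/2, 1/4 on cells j-1, j, j+1
when j < 0, and 1/2, 1/2 on cells j-1, j+1 when j ≥ 0, including across the change of spacing. -/
theorem abs_step_gap_le {ε C : ℝ} {a : ℤ → ℝ}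
    (h : ∀ j, |a (j + 1) - a j| ≤ C * cellWidth ε j) (j : ℤ) :
    |step a (j + 1) - step a j| ≤ C * cellWidth ε j := by
  have h1 := fun j => abs_le.1 (h j)
  have h2 := h1 (j - 1); have h3 := h1 j; have h4 := h1 (j + 1)
  simp only [sub_add_cancel] at h2
  rw [abs_le]
  rcases lt_trichotomy (j + 1) 0 with hj | hj | hj
  · simp only [step, hj, if_true, show j < 0 by omega, add_sub_cancel_right]
    simp only [cellWidth, hj, if_true, show j < 0 by omega, show j - 1 < 0 by omega] at *
    constructor <;> linarith
  · obtain rfl : j = -1 := by omega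
    norm_num [step, cellWidth] at *
    constructor <;> linarith
  · by_cases hj0 : j = 0
    · subst hj0
      norm_num [step, cellWidth] at *
      constructor <;> linarith
    · simp only [step, show ¬ j < 0 by omega, show ¬ (j + 1) < 0 by omega, hj0,
        show ¬ (j + 1 = 0) by omega, if_false, add_sub_cancel_right]
      simp only [cellWidth, show ¬ j < 0 by omega, show ¬ (j + 1) < 0 by omega,
        show ¬ j - 1 < 0 by omega, if_false] at *
      constructor <;> linarith

theorem abs_iterate_step_gap_le {ε C : ℝ} {a : ℤ → ℝ}
    (h : ∀ j, |a (j + 1) - a j| ≤ C * cellWidth ε j) (l : ℕ) (j : ℤ) :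
    |step^[l] a (j + 1) - step^[l] a j| ≤ C * cellWidth ε j := by
  induction l generalizing j with
  | zero => exact h j
  | succ l ih => rw [Function.iterate_succ_apply']; exact abs_step_gap_le ih j

/-- The difference quotient of a grid function on the `j`-th cell. -/
def slope (ε : ℝ) (a : ℤ → ℝ) (j : ℤ) : ℝ := (a (j + 1) - a j) / cellWidth ε j

theorem abs_slope_le {ε C : ℝ} (hε : 0 < ε) {a : ℤ → ℝ}
    (h : ∀ j, |a (j + 1) - a j| ≤ C * cellWidth ε j) (j : ℤ) : |slope ε a j| ≤ C := by
  rw [slope, abs_div, abs_of_pos (cellWidth_pos hε j), div_le_iff₀ (cellWidth_pos hε j)]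
  exact h j

/-- The scheme in conservative form. -/
theorem step_sub_self {ε : ℝ} (hε : 0 < ε) (a : ℤ → ℝ) (j : ℤ) :
    step a j - a j = ε / 2 * (slope ε a j - slope ε a (j - 1)) := by
  have := hε.ne'
  unfold step slope cellWidth
  rw [sub_add_cancel]
  rcases lt_trichotomy j 0 with hj | rfl | hj
  · simp only [hj, if_true, show j - 1 < 0 by omega]
    field_simp
    ring
  · norm_num
    field_simp
    ring
  · simp only [show ¬ j < 0 by omega, if_false, show ¬ j = 0 by omega, show ¬ j - 1 < 0 by omega]
    field_simp
    ring

theorem abs_step_sub_self_le {ε C : ℝ} (hε : 0 < ε) {a : ℤ → ℝ}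
    (h : ∀ j, |a (j + 1) - a j| ≤ C * cellWidth ε j) (j : ℤ) : |step a j - a j| ≤ C * ε := by
  rw [step_sub_self hε, abs_mul, abs_of_pos (half_pos hε)]
  have h1 := abs_slope_le hε h j
  have h2 := abs_slope_le hε h (j - 1)
  have h3 := abs_sub (slope ε a j) (slope ε a (j - 1))
  nlinarith

theorem abs_sub_le_of_gap {ε C : ℝ} (hε : 0 < ε) {a : ℤ → ℝ}
    (h : ∀ j, |a (j + 1) - a j| ≤ C * cellWidth ε j) (i j : ℤ) :
    |a i - a j| ≤ C * |gridPt ε i - gridPt ε j| := by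
  wlog hij : j ≤ i generalizing i j
  · rw [abs_sub_comm, abs_sub_comm (gridPt ε i)]
    exact this j i (by omega)
  rw [abs_of_nonneg (sub_nonneg.2 ((gridPt_strictMono hε).monotone hij))]
  induction i, hij using Int.leInduction with
  | base => simp
  | succ i hi ih =>
    have h1 := abs_sub_le (a (i + 1)) (a i) (a j)
    have h2 := h i
    rw [gridPt_add_one]
    linarith

/-- Consecutive iterates are the `l`-th iterates of `step a` and of `a`, which contraction keeps
within `M`; the increments then add up. -/
theorem abs_iterate_step_sub_iterate_le {a : ℤ → ℝ} {M : ℝ} (h : ∀ j, |step a j - a j| ≤ M)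
    (l m : ℕ) (j : ℤ) : |step^[l] a j - step^[m] a j| ≤ M * |(l : ℝ) - m| := by
  wlog hlm : m ≤ l generalizing l m
  · rw [abs_sub_comm, abs_sub_comm (l : ℝ)]
    exact this m l (by omega)
  rw [abs_of_nonneg (sub_nonneg.2 (Nat.cast_le.2 hlm))]
  induction l, hlm using Nat.le_induction with
  | base => simp
  | succ l hl ih =>
    have h1 := abs_sub_le (step^[l + 1] a j) (step^[l] a j) (step^[m] a j)
    have h2 := abs_iterate_step_sub_le h l j
    rw [← Function.iterate_succ_apply] at h2
    push_cast
    linarith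

/-! ### Consistency on smooth nodal data. -/

theorem abs_sub_sub_deriv_mul_le {f : ℝ → ℝ} {M : NNReal} (hf : Differentiable ℝ f)
    (hM : LipschitzWith M (deriv f)) (y h : ℝ) :
    |f (y + h) - f y - deriv f y * h| ≤ M * h ^ 2 := by
  have key := (convex_uIcc y (y + h)).norm_image_sub_le_of_norm_hasDerivWithin_le
    (f := fun x => f x - deriv f y * x) (f' := fun x => deriv f x - deriv f y) (C := M * |h|)
    (fun x _ => ((hf x).hasDerivAt.sub
      ((hasDerivAt_id x).const_mul (deriv f y))).hasDerivWithinAt.congr_deriv (by simp))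
    (fun x hx => by
      refine (hM.norm_sub_le x y).trans (mul_le_mul_of_nonneg_left ?_ M.coe_nonneg)
      simpa using abs_sub_left_of_mem_uIcc hx)
    left_mem_uIcc right_mem_uIcc
  simp only [Real.norm_eq_abs, add_sub_cancel_left] at key
  rw [show f (y + h) - f y - deriv f y * h
    = f (y + h) - deriv f y * (y + h) - (f y - deriv f y * y) by ring]
  refine key.trans_eq ?_
  rw [← sq_abs h]; ring

/-- First-order Taylor terms cancel because the weighted displacements sum to zero; at the origin,
(1/4)(-2ε) + (1/2)ε = 0. The worst remainder is on the left, 2·(1/4)·M(2ε)², which is M times the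
time step 2ε². -/
theorem abs_step_nodal_sub_le {f : ℝ → ℝ} {M : NNReal} (hf : Differentiable ℝ f)
    (hM : LipschitzWith M (deriv f)) (ε : ℝ) (j : ℤ) :
    |step (fun j => f (gridPt ε j)) j - f (gridPt ε j)| ≤ M * (2 * ε ^ 2) := by
  have T := abs_sub_sub_deriv_mul_le hf hM
  have hM0 := M.coe_nonneg
  have hMe : 0 ≤ M * ε ^ 2 := by positivity
  have A := gridPt_add_one ε j
  have B := gridPt_add_one ε (j - 1)
  rw [sub_add_cancel] at B
  have B' : gridPt ε (j - 1) = gridPt ε j + -cellWidth ε (j - 1) := by linarith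
  rw [abs_le]
  rcases lt_trichotomy j 0 with hj | rfl | hj
  · simp only [step, hj, if_true, A, B', cellWidth, show j - 1 < 0 by omega]
    have h1 := abs_le.1 (T (gridPt ε j) (2 * ε))
    have h2 := abs_le.1 (T (gridPt ε j) (-(2 * ε)))
    constructor <;> nlinarith
  · norm_num [step, cellWidth] at A B' ⊢
    rw [A, B']
    have h1 := abs_le.1 (T (gridPt ε 0) ε)
    have h2 := abs_le.1 (T (gridPt ε 0) (-(2 * ε)))
    constructor <;> nlinarith
  · simp only [step, show ¬ j < 0 by omega, show ¬ j = 0 by omega, if_false, A, B', cellWidth,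
      show ¬ j - 1 < 0 by omega]
    have h1 := abs_le.1 (T (gridPt ε j) ε)
    have h2 := abs_le.1 (T (gridPt ε j) (-ε))
    constructor <;> nlinarith

/-! ### Uniform estimates for the walk. -/

section

variable {w₀ : ℝ → ℝ} {L : NNReal} {ε : ℝ}

theorem abs_walk_zero_sub_le (hL : LipschitzWith L w₀) (hε : 0 < ε) (j : ℤ) {z : ℝ}
    (hz : z ∈ Icc (gridPt ε j) (gridPt ε (j + 1))) :
    |walk w₀ ε 0 j - w₀ z| ≤ L * cellWidth ε j := by
  have hw := cellWidth_pos hε j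
  have h1 : walk w₀ ε 0 j - w₀ z
      = (cellWidth ε j)⁻¹ * ∫ x in (gridPt ε j)..(gridPt ε (j + 1)), (w₀ x - w₀ z) := by
    rw [walk, gridPt_add_one_sub, intervalIntegral.integral_sub
      (hL.continuous.intervalIntegrable _ _) intervalIntegrable_const,
      intervalIntegral.integral_const, gridPt_add_one_sub, smul_eq_mul]
    field_simp
  have h2 := intervalIntegral.norm_integral_le_of_norm_le_const (a := gridPt ε j)
    (b := gridPt ε (j + 1)) (f := fun x => w₀ x - w₀ z) (C := L * cellWidth ε j) (by
      intro x hx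
      rw [uIoc_of_le (hz.1.trans hz.2)] at hx
      refine (hL.norm_sub_le x z).trans (mul_le_mul_of_nonneg_left ?_ L.coe_nonneg)
      rw [← gridPt_add_one_sub, Real.norm_eq_abs]
      exact abs_sub_le_of_le_of_le hx.1.le hx.2 hz.1 hz.2)
  rw [gridPt_add_one_sub, abs_of_pos hw, Real.norm_eq_abs] at h2
  rw [h1, abs_mul, abs_inv, abs_of_pos hw, inv_mul_le_iff₀ hw]
  linarith

theorem abs_walk_gap_le (hL : LipschitzWith L w₀) (hε : 0 < ε) (l : ℕ) (j : ℤ) :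
    |walk w₀ ε l (j + 1) - walk w₀ ε l j| ≤ 2 * L * cellWidth ε j := by
  rw [walk_eq_iterate]
  refine abs_iterate_step_gap_le (fun j => ?_) l j
  have hm := (gridPt_strictMono hε).monotone
  -- Neighbouring averages are both compared with w₀ at their common node, whence the factor 2.
  have h1 := abs_walk_zero_sub_le hL hε j (z := gridPt ε (j + 1)) ⟨hm (by omega), le_rfl⟩
  have h2 := abs_walk_zero_sub_le hL hε (j + 1) (z := gridPt ε (j + 1)) ⟨le_rfl, hm (by omega)⟩
  have h3 := mul_le_mul_of_nonneg_left (cellWidth_add_one_le hε j) L.coe_nonneg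
  rw [abs_le] at *
  constructor <;> linarith

theorem abs_walk_succ_sub_le (hL : LipschitzWith L w₀) (hε : 0 < ε) (l : ℕ) (j : ℤ) :
    |walk w₀ ε (l + 1) j - walk w₀ ε l j| ≤ 2 * L * ε := by
  rw [walk_succ]
  exact abs_step_sub_self_le hε (abs_walk_gap_le hL hε l) j

theorem abs_walk_le (hε : 0 < ε) {A : ℝ} (hA : ∀ x, |w₀ x| ≤ A) (l : ℕ) (j : ℤ) :
    |walk w₀ ε l j| ≤ A := by
  rw [walk_eq_iterate]
  refine abs_iterate_step_le (fun j => ?_) l j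
  have hw := cellWidth_pos hε j
  have h := intervalIntegral.norm_integral_le_of_norm_le_const (a := gridPt ε j)
    (b := gridPt ε (j + 1)) (f := w₀) (C := A) fun x _ => hA x
  rw [gridPt_add_one_sub, abs_of_pos hw, Real.norm_eq_abs] at h
  rw [walk, gridPt_add_one_sub, abs_mul, abs_inv, abs_of_pos hw, inv_mul_le_iff₀ hw]
  linarith

/-- Cell averages behave like midpoint values, and the midpoints are not balanced across the origin,
so their first step is in general only O(ε). The walk is therefore compared with the one started
from nodal values, at a cost of 2Lε for each of the two terms. -/
theorem abs_walk_sub_walk_le {M : NNReal} (hL : LipschitzWith L w₀) (hd : Differentiable ℝ w₀)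
    (hM : LipschitzWith M (deriv w₀)) (hε : 0 < ε) (l m : ℕ) (i j : ℤ) :
    |walk w₀ ε l i - walk w₀ ε m j|
      ≤ L * |gridPt ε i - gridPt ε j| + M * |gridTime ε l - gridTime ε m| + 4 * L * ε := by
  set b : ℤ → ℝ := fun j => w₀ (gridPt ε j) with hb
  have hmono := (gridPt_strictMono hε).monotone
  have h0 : ∀ l j, |walk w₀ ε l j - step^[l] b j| ≤ 2 * L * ε := by
    intro l j
    rw [walk_eq_iterate]
    refine abs_iterate_step_sub_le (fun j => ?_) l j
    refine (abs_walk_zero_sub_le hL hε j ⟨le_rfl, hmono (by omega)⟩).trans ?_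
    nlinarith [cellWidth_le hε j, L.coe_nonneg]
  have hgap : ∀ j, |b (j + 1) - b j| ≤ L * cellWidth ε j := by
    intro j
    refine (hL.norm_sub_le _ _).trans_eq ?_
    rw [gridPt_add_one_sub, Real.norm_eq_abs, abs_of_pos (cellWidth_pos hε j)]
  have h1 := abs_sub_le_of_gap hε (abs_iterate_step_gap_le hgap l) i j
  have h2 := abs_iterate_step_sub_iterate_le (abs_step_nodal_sub_le hd hM ε) l m j
  have h3 : M * |gridTime ε l - gridTime ε m| = M * (2 * ε ^ 2) * |(l : ℝ) - m| := by
    unfold gridTime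
    rw [show 2 * (l : ℝ) * ε ^ 2 - 2 * m * ε ^ 2 = 2 * ε ^ 2 * (l - m) by ring, abs_mul,
      abs_of_pos (by positivity : (0 : ℝ) < 2 * ε ^ 2)]
    ring
  have h4 := h0 l i
  have h5 := h0 m j
  rw [h3]
  change |step^[l] b j - step^[m] b j| ≤ _ at h2
  generalize M * (2 * ε ^ 2) * |(l : ℝ) - m| = X at *
  generalize L * |gridPt ε i - gridPt ε j| = Y at *
  rw [abs_le] at *
  constructor <;> linarith

end

/-! ### The interpolation and its approximate Lipschitz bound. -/

/-- The relative position of `t` in its time interval. -/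
def timeFrac (ε t : ℝ) : ℝ :=
  (t - gridTime ε (timeIdx ε t)) / (gridTime ε (timeIdx ε t + 1) - gridTime ε (timeIdx ε t))

/-- The relative position of `y` in its cell. -/
def spaceFrac (ε y : ℝ) : ℝ :=
  (y - gridPt ε (spaceIdx ε y)) / (gridPt ε (spaceIdx ε y + 1) - gridPt ε (spaceIdx ε y))

/-- The grid function at time `t` obtained by linear interpolation in time. -/
def timeInterp (w₀ : ℝ → ℝ) (ε t : ℝ) (j : ℤ) : ℝ :=
  (1 - timeFrac ε t) * walk w₀ ε (timeIdx ε t) j + timeFrac ε t * walk w₀ ε (timeIdx ε t + 1) j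

/-- The continuous piecewise affine interpolation of a grid function. -/
def lin (ε : ℝ) (a : ℤ → ℝ) (y : ℝ) : ℝ :=
  (1 - spaceFrac ε y) * a (spaceIdx ε y) + spaceFrac ε y * a (spaceIdx ε y + 1)

theorem interp_eq_lin (w₀ : ℝ → ℝ) (ε : ℝ) (p : ℝ × ℝ) :
    interp w₀ ε p = lin ε (timeInterp w₀ ε p.1) p.2 := by
  simp only [interp, lin, timeInterp, timeFrac, spaceFrac]
  ring

section

variable {ε : ℝ}

theorem gridTime_add_one_sub (ε : ℝ) (l : ℕ) : gridTime ε (l + 1) - gridTime ε l = 2 * ε ^ 2 := by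
  unfold gridTime; push_cast; ring

theorem timeFrac_mem (hε : 0 < ε) {t : ℝ} (ht : 0 ≤ t) : timeFrac ε t ∈ Ico (0 : ℝ) 1 := by
  have h := mem_time_cell hε ht
  have h' : 0 < gridTime ε (timeIdx ε t + 1) - gridTime ε (timeIdx ε t) := by
    linarith [h.1, h.2]
  exact ⟨div_nonneg (by linarith [h.1]) h'.le, (div_lt_one h').2 (by linarith [h.2])⟩

theorem spaceFrac_mem (hε : 0 < ε) (y : ℝ) : spaceFrac ε y ∈ Ico (0 : ℝ) 1 := by
  have h := mem_space_cell hε y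
  have h' : 0 < gridPt ε (spaceIdx ε y + 1) - gridPt ε (spaceIdx ε y) := by
    linarith [h.1, h.2]
  exact ⟨div_nonneg (by linarith [h.1]) h'.le, (div_lt_one h').2 (by linarith [h.2])⟩

theorem abs_convex_comb_le {s a b C : ℝ} (hs : s ∈ Ico (0 : ℝ) 1) (ha : |a| ≤ C) (hb : |b| ≤ C) :
    |(1 - s) * a + s * b| ≤ C := by
  have := abs_le.1 ha
  have := abs_le.1 hb
  obtain ⟨h0, h1⟩ := hs
  rw [abs_le]
  constructor <;> nlinarith

theorem abs_convex_comb_sub_le {s a b C : ℝ} (hs : s ∈ Ico (0 : ℝ) 1) (h : |b - a| ≤ C) :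
    |(1 - s) * a + s * b - a| ≤ C := by
  rw [show (1 - s) * a + s * b - a = s * (b - a) by ring, abs_mul, abs_of_nonneg hs.1]
  nlinarith [hs.1, hs.2, abs_nonneg (b - a)]

variable {w₀ : ℝ → ℝ} {L : NNReal}

theorem abs_timeInterp_le (hε : 0 < ε) {A : ℝ} (hA : ∀ x, |w₀ x| ≤ A) {t : ℝ} (ht : 0 ≤ t)
    (j : ℤ) : |timeInterp w₀ ε t j| ≤ A :=
  abs_convex_comb_le (timeFrac_mem hε ht) (abs_walk_le hε hA _ _) (abs_walk_le hε hA _ _)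

theorem abs_interp_le (hε : 0 < ε) {A : ℝ} (hA : ∀ x, |w₀ x| ≤ A) {p : ℝ × ℝ} (hp : 0 ≤ p.1) :
    |interp w₀ ε p| ≤ A := by
  rw [interp_eq_lin]
  exact abs_convex_comb_le (spaceFrac_mem hε _) (abs_timeInterp_le hε hA hp _)
    (abs_timeInterp_le hε hA hp _)

theorem abs_timeInterp_gap_le (hL : LipschitzWith L w₀) (hε : 0 < ε) {t : ℝ} (ht : 0 ≤ t) (j : ℤ) :
    |timeInterp w₀ ε t (j + 1) - timeInterp w₀ ε t j| ≤ 2 * L * cellWidth ε j := by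
  unfold timeInterp
  set s := timeFrac ε t
  set l := timeIdx ε t
  rw [show ∀ a b c d : ℝ, (1 - s) * a + s * b - ((1 - s) * c + s * d)
    = (1 - s) * (a - c) + s * (b - d) by intros; ring]
  exact abs_convex_comb_le (timeFrac_mem hε ht) (abs_walk_gap_le hL hε _ _)
    (abs_walk_gap_le hL hε _ _)

theorem abs_timeInterp_sub_walk_le (hL : LipschitzWith L w₀) (hε : 0 < ε) {t : ℝ} (ht : 0 ≤ t)
    (j : ℤ) : |timeInterp w₀ ε t j - walk w₀ ε (timeIdx ε t) j| ≤ 2 * L * ε :=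
  abs_convex_comb_sub_le (timeFrac_mem hε ht) (abs_walk_succ_sub_le hL hε _ _)

theorem abs_interp_sub_timeInterp_le (hL : LipschitzWith L w₀) (hε : 0 < ε) {p : ℝ × ℝ}
    (hp : 0 ≤ p.1) : |interp w₀ ε p - timeInterp w₀ ε p.1 (spaceIdx ε p.2)| ≤ 4 * L * ε := by
  rw [interp_eq_lin]
  refine abs_convex_comb_sub_le (spaceFrac_mem hε _)
    ((abs_timeInterp_gap_le hL hε hp _).trans ?_)
  nlinarith [cellWidth_le hε (spaceIdx ε p.2), L.coe_nonneg]

theorem abs_sub_gridPt_le (hε : 0 < ε) (y : ℝ) : |y - gridPt ε (spaceIdx ε y)| ≤ 2 * ε := by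
  have h := mem_space_cell hε y
  have h1 := gridPt_add_one_sub ε (spaceIdx ε y)
  have h2 := cellWidth_le hε (spaceIdx ε y)
  rw [abs_of_nonneg (by linarith [h.1])]
  linarith [h.2]

theorem abs_sub_gridTime_le (hε : 0 < ε) {t : ℝ} (ht : 0 ≤ t) :
    |t - gridTime ε (timeIdx ε t)| ≤ 2 * ε ^ 2 := by
  have h := mem_time_cell hε ht
  have h1 := gridTime_add_one_sub ε (timeIdx ε t)
  rw [abs_of_nonneg (by linarith [h.1])]
  linarith [h.2]

/-- Each point is rounded to a grid node, costing 4Lε in space and 2Lε in time per point. The walk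
estimate adds 4Lε, and the rounding of the nodes themselves adds 4Lε + 4Mε². -/
theorem abs_interp_sub_interp_le {M : NNReal} (hL : LipschitzWith L w₀)
    (hd : Differentiable ℝ w₀) (hM : LipschitzWith M (deriv w₀)) (hε : 0 < ε) {p q : ℝ × ℝ}
    (hp : 0 ≤ p.1) (hq : 0 ≤ q.1) :
    |interp w₀ ε p - interp w₀ ε q| ≤ (L + M) * dist p q + (20 * L * ε + 4 * M * ε ^ 2) := by
  have a1 := abs_interp_sub_timeInterp_le hL hε hp
  have a2 := abs_interp_sub_timeInterp_le hL hε hq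
  have b1 := abs_timeInterp_sub_walk_le hL hε hp (spaceIdx ε p.2)
  have b2 := abs_timeInterp_sub_walk_le hL hε hq (spaceIdx ε q.2)
  have c := abs_walk_sub_walk_le hL hd hM hε (timeIdx ε p.1) (timeIdx ε q.1)
    (spaceIdx ε p.2) (spaceIdx ε q.2)
  have d1 : |p.1 - q.1| ≤ dist p q := le_max_left (dist p.1 q.1) (dist p.2 q.2)
  have d2 : |p.2 - q.2| ≤ dist p q := le_max_right (dist p.1 q.1) (dist p.2 q.2)
  have e1 : |gridPt ε (spaceIdx ε p.2) - gridPt ε (spaceIdx ε q.2)| ≤ dist p q + 4 * ε := by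
    have := abs_sub_gridPt_le hε p.2
    have := abs_sub_gridPt_le hε q.2
    rw [abs_le] at *
    constructor <;> linarith
  have e2 : |gridTime ε (timeIdx ε p.1) - gridTime ε (timeIdx ε q.1)|
      ≤ dist p q + 4 * ε ^ 2 := by
    have := abs_sub_gridTime_le hε hp
    have := abs_sub_gridTime_le hε hq
    rw [abs_le] at *
    constructor <;> linarith
  have f1 := mul_le_mul_of_nonneg_left e1 L.coe_nonneg
  have f2 := mul_le_mul_of_nonneg_left e2 M.coe_nonneg
  have c' := c.trans (show _ ≤ (L + M) * dist p q + (8 * L * ε + 4 * M * ε ^ 2) by linarith)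
  rw [abs_le] at a1 a2 b1 b2 c' ⊢
  constructor <;> linarith

end

/-! ### Arzelà–Ascoli with a vanishing error. -/

/-- A sequence of uniformly bounded functions that is asymptotically uniformly Lipschitz has a
subsequence that converges locally uniformly to a Lipschitz function. -/
theorem exists_subseq_tendstoLocallyUniformly_of_dist_le {X : Type*} [PseudoMetricSpace X]
    [TopologicalSpace.SeparableSpace X] {f : ℕ → X → ℝ} {A : ℝ} {K : NNReal} {η : ℕ → ℝ}
    (hA : ∀ n x, |f n x| ≤ A) (hK : ∀ n x y, |f n x - f n y| ≤ K * dist x y + η n)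
    (hη : Tendsto η atTop (𝓝 0)) :
    ∃ (s : ℕ → ℕ) (g : X → ℝ), StrictMono s ∧ LipschitzWith K g ∧
      TendstoLocallyUniformly (fun i => f (s i)) g atTop := by
  rcases isEmpty_or_nonempty X with hX | hX
  · exact ⟨id, fun _ => 0, strictMono_id, fun x => hX.elim x,
      fun u _ x => hX.elim x⟩
  set d := TopologicalSpace.denseSeq X
  -- Sequential compactness of the cube [-A, A]^ℕ replaces the diagonal argument: one subsequence
  -- converges at every point of a dense sequence.
  obtain ⟨a, -, s, hs, hconv⟩ := (isCompact_univ_pi fun _ : ℕ => isCompact_Icc (a := -A) (b := A)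
    ).tendsto_subseq (x := fun n i => f n (d i)) fun n i _ => abs_le.1 (hA n (d i))
  have hηs := hη.comp hs.tendsto_atTop
  have hd : ∀ i, CauchySeq fun n => f (s n) (d i) := fun i =>
    ((tendsto_pi_nhds.1 hconv) i).cauchySeq
  have hx : ∀ x, CauchySeq fun n => f (s n) x := by
    intro x
    rw [Metric.cauchySeq_iff']
    intro e he
    obtain ⟨i, hi⟩ := (TopologicalSpace.denseRange_denseSeq X).exists_dist_lt x
      -- The shift to `K + 1` avoids division by zero when `K = 0`.
      (show 0 < e / (8 * (K + 1)) by positivity)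
    have hi' : K * dist x (d i) ≤ e / 8 := by
      have : (K : ℝ) * dist x (d i) ≤ (K + 1) * (e / (8 * (K + 1))) := by
        gcongr
        · linarith
      refine this.trans_eq ?_
      have : (K : ℝ) + 1 ≠ 0 := by positivity
      field_simp
    obtain ⟨N, hN⟩ := Metric.cauchySeq_iff.1 (hd i) (e / 4) (by positivity)
    obtain ⟨N', hN'⟩ := eventually_atTop.1
      ((tendsto_order.1 hηs).2 (e / 8) (by positivity))
    refine ⟨max N N', fun n hn => ?_⟩
    have h1 := hN n (le_of_max_le_left hn) (max N N') (le_max_left _ _)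
    have h2 := hN' n (le_of_max_le_right hn)
    have h3 := hN' (max N N') (le_max_right _ _)
    have h4 := hK (s n) x (d i)
    have h5 := hK (s (max N N')) x (d i)
    simp only [Function.comp_apply] at h2 h3
    rw [Real.dist_eq] at h1 ⊢
    rw [abs_lt] at h1 ⊢
    rw [abs_le] at h4 h5
    constructor <;> linarith
  choose g hg using fun x => cauchySeq_tendsto_of_complete (hx x)
  have hgL : ∀ x y, |g x - g y| ≤ K * dist x y := by
    intro x y
    have h := le_of_tendsto_of_tendsto' ((hg x).sub (hg y)).abs
      (tendsto_const_nhds.add hηs) fun n => hK (s n) x y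
    simpa using h
  refine ⟨s, g, hs, LipschitzWith.of_dist_le_mul hgL, ?_⟩
  rw [Metric.tendstoLocallyUniformly_iff]
  intro e he x
  refine ⟨Metric.ball x (e / (8 * (K + 1))), Metric.ball_mem_nhds _ (by positivity), ?_⟩
  filter_upwards [Metric.tendsto_nhds.1 (hg x) (e / 4) (by positivity),
    (tendsto_order.1 hηs).2 (e / 8) (by positivity)] with n hn1 hn2 y hy
  have hi' : K * dist y x ≤ e / 8 := by
    have : (K : ℝ) * dist y x ≤ (K + 1) * (e / (8 * (K + 1))) := by
      gcongr
      · linarith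
      · exact (Metric.mem_ball.1 hy).le
    refine this.trans_eq ?_
    have : (K : ℝ) + 1 ≠ 0 := by positivity
    field_simp
  have h4 := hK (s n) y x
  have h5 := hgL y x
  simp only [Function.comp_apply] at hn2
  rw [Real.dist_eq] at hn1 ⊢
  rw [abs_lt] at hn1 ⊢
  rw [abs_le] at h4 h5
  constructor <;> linarith

/-! ### Measurability and integrability. -/

theorem measurable_spaceIdx (ε : ℝ) : Measurable (spaceIdx ε) := by
  unfold spaceIdx
  exact Measurable.ite (measurableSet_lt measurable_id measurable_const)
    (Int.measurable_floor.comp (measurable_id.div_const _))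
    (Int.measurable_floor.comp (measurable_id.div_const _))

theorem measurable_timeIdx (ε : ℝ) : Measurable (timeIdx ε) :=
  Nat.measurable_floor.comp (measurable_id.div_const _)

theorem measurable_tau : Measurable tau :=
  Measurable.ite (measurableSet_lt measurable_id measurable_const)
    measurable_const measurable_const

theorem measurable_timeFrac (ε : ℝ) : Measurable (timeFrac ε) := by
  have h1 : Measurable fun t => gridTime ε (timeIdx ε t) :=
    (measurable_from_nat (f := gridTime ε)).comp (measurable_timeIdx ε)
  have h2 : Measurable fun t => gridTime ε (timeIdx ε t + 1) :=
    (measurable_from_nat (f := fun l => gridTime ε (l + 1))).comp (measurable_timeIdx ε)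
  exact (measurable_id.sub h1).div (h2.sub h1)

theorem measurable_comp_spaceIdx (ε : ℝ) (a : ℤ → ℝ) : Measurable fun y => a (spaceIdx ε y) :=
  (measurable_of_countable a).comp (measurable_spaceIdx ε)

theorem measurable_spaceFrac (ε : ℝ) : Measurable (spaceFrac ε) :=
  (measurable_id.sub (measurable_comp_spaceIdx ε (gridPt ε))).div
    ((measurable_comp_spaceIdx ε fun j => gridPt ε (j + 1)).sub
      (measurable_comp_spaceIdx ε (gridPt ε)))

theorem measurable_lin (ε : ℝ) (a : ℤ → ℝ) : Measurable (lin ε a) :=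
  ((measurable_const.sub (measurable_spaceFrac ε)).mul (measurable_comp_spaceIdx ε a)).add
    ((measurable_spaceFrac ε).mul (measurable_comp_spaceIdx ε fun j => a (j + 1)))

theorem measurable_timeInterp_comp (w₀ : ℝ → ℝ) (ε : ℝ) (σ : ℤ → ℤ) :
    Measurable fun p : ℝ × ℝ => timeInterp w₀ ε p.1 (σ (spaceIdx ε p.2)) := by
  have hi : Measurable fun p : ℝ × ℝ => (timeIdx ε p.1, spaceIdx ε p.2) :=
    ((measurable_timeIdx ε).comp measurable_fst).prodMk
      ((measurable_spaceIdx ε).comp measurable_snd)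
  have h1 : Measurable fun p : ℝ × ℝ => walk w₀ ε (timeIdx ε p.1) (σ (spaceIdx ε p.2)) :=
    (measurable_of_countable fun q : ℕ × ℤ => walk w₀ ε q.1 (σ q.2)).comp hi
  have h2 : Measurable fun p : ℝ × ℝ => walk w₀ ε (timeIdx ε p.1 + 1) (σ (spaceIdx ε p.2)) :=
    (measurable_of_countable fun q : ℕ × ℤ => walk w₀ ε (q.1 + 1) (σ q.2)).comp hi
  have h3 : Measurable fun p : ℝ × ℝ => timeFrac ε p.1 :=
    (measurable_timeFrac ε).comp measurable_fst
  exact ((measurable_const.sub h3).mul h1).add (h3.mul h2)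

theorem measurable_interp (w₀ : ℝ → ℝ) (ε : ℝ) : Measurable (interp w₀ ε) := by
  have h3 : Measurable fun p : ℝ × ℝ => spaceFrac ε p.2 :=
    (measurable_spaceFrac ε).comp measurable_snd
  have := ((measurable_const (a := (1 : ℝ))).sub h3).mul (measurable_timeInterp_comp w₀ ε id) |>.add
    (h3.mul (measurable_timeInterp_comp w₀ ε (· + 1)))
  convert! this using 1
  funext p
  exact interp_eq_lin w₀ ε p

/-- The classical `y`-derivative of the interpolation away from the grid lines. -/
def interpDerivY (w₀ : ℝ → ℝ) (ε : ℝ) (p : ℝ × ℝ) : ℝ :=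
  slope ε (timeInterp w₀ ε p.1) (spaceIdx ε p.2)

theorem measurable_interpDerivY (w₀ : ℝ → ℝ) (ε : ℝ) : Measurable (interpDerivY w₀ ε) :=
  ((measurable_timeInterp_comp w₀ ε (· + 1)).sub (measurable_timeInterp_comp w₀ ε id)).div
    ((measurable_comp_spaceIdx ε (cellWidth ε)).comp measurable_snd)

theorem integrable_of_bound_of_support {X : Type*} [TopologicalSpace X] [MeasurableSpace X]
    {μ : Measure X} [IsFiniteMeasureOnCompacts μ] {F : X → ℝ}
    (hF : Measurable F) {C : ℝ} (hC : ∀ x, |F x| ≤ C) {K : Set X} (hK : IsCompact K)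
    (hs : ∀ x, F x ≠ 0 → x ∈ K) : Integrable F μ := by
  rw [← integrableOn_iff_integrable_of_support_subset (s := K) hs]
  exact Measure.integrableOn_of_bounded (M := C) hK.measure_lt_top.ne
    hF.aestronglyMeasurable (ae_of_all _ hC)

/-! ### Summation over cells and discrete integration by parts in space. -/

section

variable {ε : ℝ}

theorem hasSum_setIntegral_cell (hε : 0 < ε) {F : ℝ → ℝ} (hF : Integrable F) :
    HasSum (fun j => ∫ y in Ico (gridPt ε j) (gridPt ε (j + 1)), F y) (∫ y, F y) := by
  have hU : ⋃ j, Ico (gridPt ε j) (gridPt ε (j + 1)) = univ :=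
    eq_univ_of_forall fun y => mem_iUnion.2 ⟨_, mem_space_cell hε y⟩
  have h := hasSum_integral_iUnion (μ := volume) (f := F)
    (s := fun j => Ico (gridPt ε j) (gridPt ε (j + 1))) (fun j => measurableSet_Ico)
    (fun i j hij => disjoint_left.2 fun y hi hj =>
      hij (((spaceIdx_eq_iff hε y i).2 hi).symm.trans ((spaceIdx_eq_iff hε y j).2 hj)))
    hF.integrableOn
  rwa [hU, setIntegral_univ] at h

theorem mul_abs_le_abs_gridPt (hε : 0 < ε) (j : ℤ) : ε * |(j : ℝ)| ≤ |gridPt ε j| := by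
  unfold gridPt
  split_ifs <;> rw [abs_mul, abs_of_pos hε]
  · rw [abs_mul, abs_two]
    nlinarith [mul_nonneg hε.le (abs_nonneg (j : ℝ))]
  · rw [mul_comm]

theorem finite_support_comp_gridPt (hε : 0 < ε) {ψ : ℝ → ℝ} (hψ : HasCompactSupport ψ) :
    {j | ψ (gridPt ε j) ≠ 0}.Finite := by
  obtain ⟨R, hR⟩ := hψ.isBounded.subset_closedBall 0
  refine (finite_Icc (-⌈R / ε⌉) ⌈R / ε⌉).subset fun j hj => ?_
  have h1 := hR (subset_tsupport ψ hj)
  rw [mem_closedBall_zero_iff, Real.norm_eq_abs] at h1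
  have h2 := (mul_abs_le_abs_gridPt hε j).trans h1
  rw [mul_comm, ← le_div_iff₀ hε] at h2
  have h3 := abs_le.1 (h2.trans (Int.le_ceil (R / ε)))
  exact ⟨by exact_mod_cast h3.1, by exact_mod_cast h3.2⟩

theorem hasSum_sub_shift {X : ℤ → ℝ} (hX : X.support.Finite) :
    HasSum (fun j => X (j + 1) - X j) 0 := by
  have h : HasSum X (∑' j, X j) := (summable_of_hasFiniteSupport hX).hasSum
  have h' := (Equiv.addRight (1 : ℤ)).hasSum_iff.2 h
  simpa using h'.sub h

theorem setIntegral_cell_eq_sub (hε : 0 < ε) (j : ℤ) {F F' : ℝ → ℝ}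
    (hF : ∀ y, HasDerivAt F (F' y) y) (hc : Continuous F') :
    ∫ y in Ico (gridPt ε j) (gridPt ε (j + 1)), F' y
      = F (gridPt ε (j + 1)) - F (gridPt ε j) := by
  rw [integral_Ico_eq_integral_Ioc, ← intervalIntegral.integral_of_le
    ((gridPt_strictMono hε).monotone (by omega))]
  exact intervalIntegral.integral_eq_sub_of_hasDerivAt (fun y _ => hF y)
    (hc.intervalIntegrable _ _)

theorem hasDerivAt_of_contDiff_one {ψ : ℝ → ℝ} (hψ : ContDiff ℝ 1 ψ) (y : ℝ) :
    HasDerivAt ψ (deriv ψ y) y := (hψ.differentiable one_ne_zero y).hasDerivAt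

/-- On a cell the interpolant is affine, so the two integrands add up to the derivative of its
product with ψ. The affine pieces agree at the nodes, and the boundary terms telescope. -/
theorem integral_lin_mul_deriv (hε : 0 < ε) {a : ℤ → ℝ} {A C : ℝ} (hA : ∀ j, |a j| ≤ A)
    (hC : ∀ j, |a (j + 1) - a j| ≤ C * cellWidth ε j) {ψ : ℝ → ℝ} (hψ : ContDiff ℝ 1 ψ)
    (hs : HasCompactSupport ψ) :
    ∫ y, lin ε a y * deriv ψ y = -∫ y, slope ε a (spaceIdx ε y) * ψ y := by
  have hd := hψ.continuous_deriv_one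
  have i1 : Integrable fun y => lin ε a y * deriv ψ y :=
    (hd.integrable_of_hasCompactSupport hs.deriv).bdd_mul (measurable_lin ε a).aestronglyMeasurable
      (ae_of_all _ fun y => abs_convex_comb_le (spaceFrac_mem hε y) (hA _) (hA _))
  have i2 : Integrable fun y => slope ε a (spaceIdx ε y) * ψ y :=
    (hψ.continuous.integrable_of_hasCompactSupport hs).bdd_mul
      (measurable_comp_spaceIdx ε (slope ε a)).aestronglyMeasurable
      (ae_of_all _ fun y => abs_slope_le hε hC _)
  rw [eq_neg_iff_add_eq_zero, ← integral_add i1 i2]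
  refine (hasSum_setIntegral_cell hε (i1.add i2)).unique ?_
  convert! hasSum_sub_shift (X := fun j => a j * ψ (gridPt ε j))
    ((finite_support_comp_gridPt hε hs).subset fun j hj => right_ne_zero_of_mul hj) using 1
  funext j
  have hw := (cellWidth_pos hε j).ne'
  have h := setIntegral_cell_eq_sub hε j
    (F := fun y => (a j + slope ε a j * (y - gridPt ε j)) * ψ y)
    (F' := fun y => (slope ε a j) * ψ y + (a j + slope ε a j * (y - gridPt ε j)) * deriv ψ y)
    (fun y => by
      have := ((((hasDerivAt_id y).sub_const (gridPt ε j)).const_mul (slope ε a j)).const_add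
        (a j)).mul (hasDerivAt_of_contDiff_one hψ y)
      simp only [mul_one, id] at this
      exact this) (by have := hψ.continuous; fun_prop)
  rw [gridPt_add_one_sub, sub_self, mul_zero, add_zero,
    show a j + slope ε a j * cellWidth ε j = a (j + 1) by
      unfold slope; field_simp; ring] at h
  rw [← h]
  refine setIntegral_congr_fun measurableSet_Ico fun y hy => ?_
  simp only [Pi.add_apply]
  rw [lin, spaceFrac, (spaceIdx_eq_iff hε y j).2 hy, gridPt_add_one_sub, slope]
  field_simp
  ring

theorem abs_le_of_gridPt_mem (hε : 0 < ε) {y R : ℝ} (h : |gridPt ε (spaceIdx ε y)| ≤ R) :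
    |y| ≤ R + 2 * ε := by
  have := abs_sub_gridPt_le hε y
  rw [abs_le] at *
  constructor <;> linarith

theorem integrable_tau_mul_comp_spaceIdx (hε : 0 < ε) {b : ℤ → ℝ} {B : ℝ} (hB : ∀ j, |b j| ≤ B)
    {ψ : ℝ → ℝ} (hψ : Continuous ψ) (hs : HasCompactSupport ψ) :
    Integrable fun y => tau y * b (spaceIdx ε y) * ψ (gridPt ε (spaceIdx ε y)) := by
  obtain ⟨R, hR⟩ := hs.isBounded.subset_closedBall 0
  obtain ⟨D, hD⟩ := hs.exists_bound_of_continuous hψ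
  refine integrable_of_bound_of_support (C := 2 * B * D) (K := Icc (-(R + 2 * ε)) (R + 2 * ε))
    ((measurable_tau.mul (measurable_comp_spaceIdx ε b)).mul
      (measurable_comp_spaceIdx ε fun j => ψ (gridPt ε j))) (fun y => ?_) isCompact_Icc
    fun y hy => ?_
  · have hB0 : 0 ≤ B := (abs_nonneg _).trans (hB 0)
    rw [abs_mul, abs_mul]
    exact mul_le_mul (mul_le_mul (abs_tau_le y) (hB _) (abs_nonneg _) zero_le_two) (hD _)
      (abs_nonneg _) (by positivity)
  · have h1 := hR (subset_tsupport ψ (right_ne_zero_of_mul hy))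
    rw [mem_closedBall_zero_iff, Real.norm_eq_abs] at h1
    exact abs_le.1 (abs_le_of_gridPt_mem hε h1)

/-- The weak form in space of one step of the scheme. -/
theorem half_integral_slope_mul_deriv (hε : 0 < ε) {a : ℤ → ℝ} {C : ℝ}
    (hC : ∀ j, |a (j + 1) - a j| ≤ C * cellWidth ε j) {ψ : ℝ → ℝ} (hψ : ContDiff ℝ 1 ψ)
    (hs : HasCompactSupport ψ) :
    1 / 2 * ∫ y, slope ε a (spaceIdx ε y) * deriv ψ y
      = -((2 * ε ^ 2)⁻¹ * ∫ y, tau y * (step a (spaceIdx ε y) - a (spaceIdx ε y))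
          * ψ (gridPt ε (spaceIdx ε y))) := by
  have hd := hψ.continuous_deriv_one
  have i1 : Integrable fun y => slope ε a (spaceIdx ε y) * deriv ψ y :=
    (hd.integrable_of_hasCompactSupport hs.deriv).bdd_mul
      (measurable_comp_spaceIdx ε (slope ε a)).aestronglyMeasurable
      (ae_of_all _ fun y => abs_slope_le hε hC _)
  have i2 := integrable_tau_mul_comp_spaceIdx hε (b := fun j => step a j - a j)
    (fun j => abs_step_sub_self_le hε hC j) hψ.continuous hs
  have s1 := (hasSum_setIntegral_cell hε i1).mul_left (1 / 2)
  have s2 := (hasSum_setIntegral_cell hε i2).mul_left (2 * ε ^ 2)⁻¹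
  rw [eq_neg_iff_add_eq_zero]
  refine (s1.add s2).unique ?_
  -- With s the slopes, each cell contributes half of s_j(ψ_{j+1} - ψ_j) + (s_j - s_{j-1})ψ_j = s_j
  -- ψ_{j+1} - s_{j-1} ψ_j, which telescopes.
  convert! (hasSum_sub_shift (X := fun j => slope ε a (j - 1) * ψ (gridPt ε j))
    ((finite_support_comp_gridPt hε hs).subset fun j hj => right_ne_zero_of_mul hj)).mul_left
      (1 / 2 : ℝ) using 1
  · funext j
    have h1 : ∫ y in Ico (gridPt ε j) (gridPt ε (j + 1)), slope ε a (spaceIdx ε y) * deriv ψ y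
        = slope ε a j * (ψ (gridPt ε (j + 1)) - ψ (gridPt ε j)) := by
      rw [← setIntegral_cell_eq_sub hε j (hasDerivAt_of_contDiff_one hψ) hd,
        ← integral_const_mul]
      refine setIntegral_congr_fun measurableSet_Ico fun y hy => ?_
      simp only [(spaceIdx_eq_iff hε y j).2 hy]
    have h2 : ∫ y in Ico (gridPt ε j) (gridPt ε (j + 1)),
        tau y * (step a (spaceIdx ε y) - a (spaceIdx ε y)) * ψ (gridPt ε (spaceIdx ε y))
        = 2 * ε * (step a j - a j) * ψ (gridPt ε j) := by
      rw [setIntegral_congr_fun (g := fun _ => (if j < 0 then 1 else 2) * (step a j - a j)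
        * ψ (gridPt ε j)) measurableSet_Ico fun y hy => by
          simp only [(spaceIdx_eq_iff hε y j).2 hy, tau_eq_of_mem_cell hε hy]]
      -- The weight times the width is 1·2ε on the left and 2·ε on the right; this is where τ
      -- matches the grid.
      rw [setIntegral_const, Measure.real, Real.volume_Ico, gridPt_add_one_sub,
        ENNReal.toReal_ofReal (cellWidth_pos hε j).le, smul_eq_mul, cellWidth]
      split_ifs <;> ring
    rw [h1, h2, step_sub_self hε, add_sub_cancel_right]
    field_simp
    ring
  · simp

end

/-! ### Weak y-derivatives on the half-plane. -/

theorem volume_restrict_openHalf :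
    (volume : Measure (ℝ × ℝ)).restrict openHalf
      = ((volume : Measure ℝ).restrict (Ioi 0)).prod volume := by
  rw [openHalf, Measure.volume_eq_prod, ← Measure.prod_restrict, Measure.restrict_univ]

theorem measurableSet_openHalf : MeasurableSet openHalf := measurableSet_Ioi.prod .univ

theorem measurableSet_closedHalf : MeasurableSet closedHalf := measurableSet_Ici.prod .univ

theorem openHalf_subset_closedHalf : openHalf ⊆ closedHalf :=
  prod_mono Ioi_subset_Ici_self subset_rfl

theorem pos_of_mem_openHalf {p : ℝ × ℝ} (hp : p ∈ openHalf) : 0 < p.1 := hp.1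

theorem ae_restrict_openHalf {P : ℝ × ℝ → Prop} (h : ∀ p ∈ openHalf, P p) :
    ∀ᵐ p ∂(volume.restrict openHalf), P p :=
  (ae_restrict_iff' measurableSet_openHalf).2 (ae_of_all _ h)

section

variable {φ : ℝ × ℝ → ℝ}

theorem hasDerivAt_slice_snd (hφ : ContDiff ℝ 1 φ) (t y : ℝ) :
    HasDerivAt (fun y => φ (t, y)) (fderiv ℝ φ (t, y) (0, 1)) y :=
  ((hφ.differentiable one_ne_zero (t, y)).hasFDerivAt.comp_hasDerivAt y
    ((hasDerivAt_const y t).prodMk (hasDerivAt_id y)))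

theorem hasDerivAt_slice_fst (hφ : ContDiff ℝ 1 φ) (t y : ℝ) :
    HasDerivAt (fun t => φ (t, y)) (fderiv ℝ φ (t, y) (1, 0)) t :=
  ((hφ.differentiable one_ne_zero (t, y)).hasFDerivAt.comp_hasDerivAt t
    ((hasDerivAt_id t).prodMk (hasDerivAt_const t y)))

theorem contDiff_slice_snd (hφ : ContDiff ℝ 1 φ) (t : ℝ) : ContDiff ℝ 1 fun y => φ (t, y) :=
  hφ.comp (contDiff_const.prodMk contDiff_id)

theorem hasCompactSupport_slice_snd (hs : HasCompactSupport φ) (t : ℝ) :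
    HasCompactSupport fun y => φ (t, y) := by
  refine HasCompactSupport.intro (hs.isCompact.image continuous_snd) fun y hy => ?_
  by_contra h
  exact hy ⟨(t, y), subset_tsupport φ h, rfl⟩

theorem continuous_fderiv_apply_const (hφ : ContDiff ℝ 1 φ) (v : ℝ × ℝ) :
    Continuous fun p => fderiv ℝ φ p v :=
  (hφ.continuous_fderiv one_ne_zero).clm_apply continuous_const

theorem integrable_fderiv_apply (hφ : ContDiff ℝ 1 φ) (hs : HasCompactSupport φ) (v : ℝ × ℝ)
    {μ : Measure (ℝ × ℝ)} [IsFiniteMeasureOnCompacts μ] :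
    Integrable (fun p => fderiv ℝ φ p v) μ :=
  (continuous_fderiv_apply_const hφ v).integrable_of_hasCompactSupport (hs.fderiv_apply ℝ v)

/-- Integration by parts in `y` on the half-plane, from integration by parts on each line. -/
theorem integral_openHalf_mul_deriv_snd {f g : ℝ × ℝ → ℝ} {A C : ℝ} (hf : Measurable f)
    (hg : Measurable g) (hA : ∀ p ∈ openHalf, |f p| ≤ A) (hC : ∀ p ∈ openHalf, |g p| ≤ C)
    (h : ∀ t > 0, ∀ ψ : ℝ → ℝ, ContDiff ℝ 1 ψ → HasCompactSupport ψ →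
      ∫ y, f (t, y) * deriv ψ y = -∫ y, g (t, y) * ψ y)
    (hφ : ContDiff ℝ 1 φ) (hs : HasCompactSupport φ) :
    ∫ p in openHalf, f p * deriv (fun y => φ (p.1, y)) p.2 = -∫ p in openHalf, g p * φ p := by
  have i1 : Integrable (fun p => f p * deriv (fun y => φ (p.1, y)) p.2)
      (volume.restrict openHalf) := by
    simp only [(hasDerivAt_slice_snd hφ _ _).deriv]
    exact (integrable_fderiv_apply hφ hs _).bdd_mul hf.aestronglyMeasurable
      (ae_restrict_openHalf hA)
  have i2 : Integrable (fun p => g p * φ p) (volume.restrict openHalf) :=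
    (hφ.continuous.integrable_of_hasCompactSupport hs).bdd_mul hg.aestronglyMeasurable
      (ae_restrict_openHalf hC)
  rw [volume_restrict_openHalf] at *
  rw [integral_prod _ i1, integral_prod _ i2, ← integral_neg]
  exact setIntegral_congr_fun measurableSet_Ioi fun t ht =>
    h t ht _ (contDiff_slice_snd hφ t) (hasCompactSupport_slice_snd hs t)

end

theorem locallyIntegrableOn_of_bound {f : ℝ × ℝ → ℝ} {s : Set (ℝ × ℝ)} {A : ℝ} (hf : Measurable f)
    (hsm : MeasurableSet s) (hA : ∀ p ∈ s, |f p| ≤ A) : LocallyIntegrableOn f s := by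
  intro x _
  refine ⟨Metric.closedBall x 1 ∩ s,
    inter_mem (mem_nhdsWithin_of_mem_nhds (Metric.closedBall_mem_nhds x one_pos))
      self_mem_nhdsWithin, ?_⟩
  refine Measure.integrableOn_of_bounded (M := A) ?_ hf.aestronglyMeasurable ?_
  · exact ((measure_mono inter_subset_left).trans_lt
      (isCompact_closedBall x 1).measure_lt_top).ne
  · exact (ae_restrict_iff' (Metric.isClosed_closedBall.measurableSet.inter hsm)).2
      (ae_of_all _ fun p hp => hA p hp.2)

section

variable {w₀ : ℝ → ℝ} {L : NNReal} {ε : ℝ}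

theorem abs_interpDerivY_le (hL : LipschitzWith L w₀) (hε : 0 < ε) {p : ℝ × ℝ} (hp : 0 ≤ p.1) :
    |interpDerivY w₀ ε p| ≤ 2 * L :=
  abs_slope_le hε (abs_timeInterp_gap_le hL hε hp) _

theorem integral_openHalf_interp_mul_deriv_snd (hL : LipschitzWith L w₀) (hε : 0 < ε) {A : ℝ}
    (hA : ∀ x, |w₀ x| ≤ A) {φ : ℝ × ℝ → ℝ} (hφ : ContDiff ℝ 1 φ) (hs : HasCompactSupport φ) :
    ∫ p in openHalf, interp w₀ ε p * deriv (fun y => φ (p.1, y)) p.2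
      = -∫ p in openHalf, interpDerivY w₀ ε p * φ p := by
  refine integral_openHalf_mul_deriv_snd (measurable_interp w₀ ε) (measurable_interpDerivY w₀ ε)
    (fun p hp => abs_interp_le hε hA (pos_of_mem_openHalf hp).le)
    (fun p hp => abs_interpDerivY_le hL hε (pos_of_mem_openHalf hp).le)
    (fun t ht ψ hψ hψs => ?_) hφ hs
  simp only [interp_eq_lin, interpDerivY]
  exact integral_lin_mul_deriv hε (abs_timeInterp_le hε hA ht.le)
    (abs_timeInterp_gap_le hL hε ht.le) hψ hψs

end

section

variable {w : ℝ × ℝ → ℝ} {K : NNReal}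

theorem measurable_lineDeriv_snd (hw : LipschitzWith K w) :
    Measurable fun p => lineDeriv ℝ w p (0, 1) := measurable_lineDeriv hw.continuous

/-- The bound holds at every point, since `lineDeriv` takes the value 0 where the derivative does
not exist. -/
theorem abs_lineDeriv_snd_le (hw : LipschitzWith K w) (p : ℝ × ℝ) :
    |lineDeriv ℝ w p (0, 1)| ≤ K := by
  refine (norm_lineDeriv_le_of_lipschitz ℝ hw).trans_eq ?_
  simp [Prod.norm_def]

theorem integral_openHalf_lipschitz_mul_deriv_snd (hw : LipschitzWith K w) {A : ℝ}
    (hA : ∀ p, |w p| ≤ A) {φ : ℝ × ℝ → ℝ} (hφ : ContDiff ℝ 1 φ) (hs : HasCompactSupport φ) :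
    ∫ p in openHalf, w p * deriv (fun y => φ (p.1, y)) p.2
      = -∫ p in openHalf, lineDeriv ℝ w p (0, 1) * φ p := by
  refine integral_openHalf_mul_deriv_snd hw.continuous.measurable (measurable_lineDeriv_snd hw)
    (fun p _ => hA p) (fun p _ => abs_lineDeriv_snd_le hw p) (fun t ht ψ hψ hψs => ?_) hφ hs
  have hslice : LipschitzWith K fun y => w (t, y) := by
    have := hw.comp (LipschitzWith.prodMk_left t)
    rwa [mul_one] at this
  obtain ⟨D, hD⟩ := hψ.lipschitzWith_of_hasCompactSupport hψs one_ne_zero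
  have h := hslice.integral_lineDeriv_mul_eq (μ := volume) hD hψs 1
  have e1 : ∀ y, lineDeriv ℝ (fun y => w (t, y)) y 1 = lineDeriv ℝ w (t, y) (0, 1) := by
    intro y; simp [lineDeriv]
  have e2 : ∀ y, lineDeriv ℝ ψ y (-1) = -deriv ψ y := by
    intro y
    rw [(hψ.differentiable one_ne_zero y).lineDeriv_eq_fderiv, map_neg, fderiv_apply_one_eq_deriv]
  simp only [e1, e2] at h
  rw [h, ← integral_neg]
  congr 1
  funext y
  ring

end

theorem hasWeakDerivY_of_bound {f g : ℝ × ℝ → ℝ} {A C : ℝ} (hf : Measurable f)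
    (hg : Measurable g) (hA : ∀ p ∈ openHalf, |f p| ≤ A) (hC : ∀ p ∈ openHalf, |g p| ≤ C)
    (h : ∀ φ : ℝ × ℝ → ℝ, ContDiff ℝ 1 φ → HasCompactSupport φ →
      ∫ p in openHalf, f p * deriv (fun y => φ (p.1, y)) p.2 = -∫ p in openHalf, g p * φ p) :
    HasWeakDerivY f g :=
  ⟨locallyIntegrableOn_of_bound hf measurableSet_openHalf hA,
    locallyIntegrableOn_of_bound hg measurableSet_openHalf hC,
    fun φ hφ hs _ => h φ (hφ.of_le (by exact_mod_cast le_top)) hs⟩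

/-! ### Weak* convergence. -/

/-- Bounded weak derivatives of a bounded pointwise convergent sequence converge weakly*. -/
theorem tendstoWeakStar_of_tendsto {f g : ℕ → ℝ × ℝ → ℝ} {F G : ℝ × ℝ → ℝ} {A C : ℝ}
    (hf : ∀ i, Measurable (f i)) (hg : ∀ i, Measurable (g i)) (hG : Measurable G)
    (hA : ∀ i, ∀ p ∈ openHalf, |f i p| ≤ A) (hC : ∀ i, ∀ p ∈ openHalf, |g i p| ≤ C)
    (hGC : ∀ p ∈ openHalf, |G p| ≤ C)
    (hfg : ∀ i, ∀ φ : ℝ × ℝ → ℝ, ContDiff ℝ 1 φ → HasCompactSupport φ →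
      ∫ p in openHalf, f i p * deriv (fun y => φ (p.1, y)) p.2 = -∫ p in openHalf, g i p * φ p)
    (hFG : ∀ φ : ℝ × ℝ → ℝ, ContDiff ℝ 1 φ → HasCompactSupport φ →
      ∫ p in openHalf, F p * deriv (fun y => φ (p.1, y)) p.2 = -∫ p in openHalf, G p * φ p)
    (hlim : ∀ p ∈ openHalf, Tendsto (fun i => f i p) atTop (𝓝 (F p))) : TendstoWeakStar g G := by
  refine ⟨fun i => memLp_top_of_bound (hg i).aestronglyMeasurable C (ae_restrict_openHalf (hC i)),
    memLp_top_of_bound hG.aestronglyMeasurable C (ae_restrict_openHalf hGC), fun h hh => ?_⟩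
  have hC0 : 0 ≤ C := (abs_nonneg _).trans (hGC (1, 0) ⟨mem_Ioi.2 one_pos, mem_univ _⟩)
  rw [Metric.tendsto_atTop']
  intro e he
  have he' : 0 < e / (4 * (C + 1)) := by positivity
  -- The approximant need not vanish at t = 0. This is harmless: integration by parts in y has no
  -- boundary term there, and `hfg` and `hFG` cover such functions.
  obtain ⟨φ, hs, hφ, hφe⟩ := (memLp_one_iff_integrable.2 hh).exist_eLpNorm_sub_le
    ENNReal.one_ne_top le_rfl he'
  have hφ1 : ContDiff ℝ 1 φ := hφ.of_le (by exact_mod_cast le_top)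
  have hφi : Integrable φ (volume.restrict openHalf) :=
    hφ1.continuous.integrable_of_hasCompactSupport hs
  have hd : ∫ p in openHalf, ‖(h - φ) p‖ ≤ e / (4 * (C + 1)) := by
    rw [integral_norm_eq_lintegral_enorm (hh.sub hφi).aestronglyMeasurable,
      ← eLpNorm_one_eq_lintegral_enorm]
    exact ENNReal.toReal_le_of_le_ofReal (by positivity) hφe
  have hsplit : ∀ k : ℝ × ℝ → ℝ, Measurable k → (∀ p ∈ openHalf, |k p| ≤ C) →
      |(∫ p in openHalf, k p * h p) - ∫ p in openHalf, k p * φ p| ≤ e / 4 := by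
    intro k hk hkC
    have hb : ∀ᵐ p ∂(volume.restrict openHalf), ‖k p‖ ≤ C := ae_restrict_openHalf hkC
    rw [← integral_sub (hh.bdd_mul hk.aestronglyMeasurable hb)
      (hφi.bdd_mul hk.aestronglyMeasurable hb)]
    calc |∫ p in openHalf, (k p * h p - k p * φ p)|
        ≤ ∫ p in openHalf, C * ‖(h - φ) p‖ := by
          rw [← Real.norm_eq_abs]
          refine norm_integral_le_of_norm_le ((hh.sub hφi).norm.const_mul C) ?_
          filter_upwards [hb] with p hp
          rw [← mul_sub, norm_mul]
          exact mul_le_mul_of_nonneg_right hp (norm_nonneg _)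
      _ = C * ∫ p in openHalf, ‖(h - φ) p‖ := integral_const_mul _ _
      _ ≤ (C + 1) * (e / (4 * (C + 1))) := by
          gcongr
          linarith
      _ = e / 4 := by field_simp
  have hconv : Tendsto (fun i => ∫ p in openHalf, g i p * φ p) atTop
      (𝓝 (∫ p in openHalf, G p * φ p)) := by
    have e1 : ∀ i, ∫ p in openHalf, g i p * φ p
        = -∫ p in openHalf, f i p * deriv (fun y => φ (p.1, y)) p.2 := fun i => by
      rw [hfg i φ hφ1 hs, neg_neg]
    have e2 : ∫ p in openHalf, G p * φ p
        = -∫ p in openHalf, F p * deriv (fun y => φ (p.1, y)) p.2 := by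
      rw [hFG φ hφ1 hs, neg_neg]
    simp only [e1, e2, (hasDerivAt_slice_snd hφ1 _ _).deriv]
    refine (tendsto_integral_of_dominated_convergence
      (fun p => A * ‖fderiv ℝ φ p (0, 1)‖) (fun i => ?_) ?_ (fun i => ?_) ?_).neg
    · exact ((hf i).mul (continuous_fderiv_apply_const hφ1 _).measurable).aestronglyMeasurable
    · exact (integrable_fderiv_apply hφ1 hs _).norm.const_mul A
    · refine ae_restrict_openHalf fun p hp => ?_
      rw [norm_mul]
      exact mul_le_mul_of_nonneg_right (hA i p hp) (norm_nonneg _)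
    · exact ae_restrict_openHalf fun p hp => (hlim p hp).mul_const _
  obtain ⟨N, hN⟩ := Metric.tendsto_atTop'.1 hconv (e / 4) (by positivity)
  refine ⟨N, fun i hi => ?_⟩
  have h1 := hsplit (g i) (hg i) (hC i)
  have h2 := hsplit G hG hGC
  have h3 := hN i hi
  rw [Real.dist_eq] at h3 ⊢
  rw [abs_lt] at h3 ⊢
  rw [abs_le] at h1 h2
  constructor <;> linarith

/-! ### The discrete weak formulation in space and time. -/

theorem step_convex_comb (s : ℝ) (a b : ℤ → ℝ) (j : ℤ) :
    step (fun j => (1 - s) * a j + s * b j) j = (1 - s) * step a j + s * step b j := by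
  simp only [step]
  split_ifs <;> ring

theorem timeIdx_add_timeStep {ε t : ℝ} (hε : 0 < ε) (ht : 0 ≤ t) :
    timeIdx ε (t + 2 * ε ^ 2) = timeIdx ε t + 1 := by
  have hk : (0 : ℝ) < 2 * ε ^ 2 := by positivity
  rw [timeIdx, add_div, div_self hk.ne', Nat.floor_add_one (div_nonneg ht hk.le), timeIdx]

/-- The shift preserves the relative position in the time interval, and the linear `step` commutes
with interpolation. Hence the scheme holds at every time t ≥ 0, not only at grid times. -/
theorem timeInterp_add_timeStep (w₀ : ℝ → ℝ) {ε t : ℝ} (hε : 0 < ε) (ht : 0 ≤ t) (j : ℤ) :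
    timeInterp w₀ ε (t + 2 * ε ^ 2) j = step (timeInterp w₀ ε t) j := by
  have hs : timeFrac ε (t + 2 * ε ^ 2) = timeFrac ε t := by
    simp only [timeFrac, timeIdx_add_timeStep hε ht, gridTime_add_one_sub]
    rw [show t + 2 * ε ^ 2 - gridTime ε (timeIdx ε t + 1) = t - gridTime ε (timeIdx ε t) by
      linarith [gridTime_add_one_sub ε (timeIdx ε t)]]
  unfold timeInterp
  rw [step_convex_comb, hs, timeIdx_add_timeStep hε ht, walk_succ _ _ (timeIdx ε t + 1),
    walk_succ _ _ (timeIdx ε t)]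

/-- The test function at time `t'` sampled at the left end of each cell, multiplied by the grid
function at time `t` and by the weight `τ`. -/
def sampledPairing (w₀ : ℝ → ℝ) (ε : ℝ) (φ : ℝ × ℝ → ℝ) (t t' y : ℝ) : ℝ :=
  tau y * timeInterp w₀ ε t (spaceIdx ε y) * φ (t', gridPt ε (spaceIdx ε y))

theorem measurable_gridPt_spaceIdx (ε : ℝ) : Measurable fun y => gridPt ε (spaceIdx ε y) :=
  measurable_comp_spaceIdx ε (gridPt ε)

theorem measurable_sampledPairing (w₀ : ℝ → ℝ) (ε : ℝ) {φ : ℝ × ℝ → ℝ} (hφ : Continuous φ)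
    {α β : ℝ → ℝ} (hα : Measurable α) (hβ : Measurable β) :
    Measurable fun p : ℝ × ℝ => sampledPairing w₀ ε φ (α p.1) (β p.1) p.2 := by
  have h1 : Measurable fun p : ℝ × ℝ => timeInterp w₀ ε (α p.1) (spaceIdx ε p.2) :=
    (measurable_timeInterp_comp w₀ ε id).comp ((hα.comp measurable_fst).prodMk measurable_snd)
  have h2 : Measurable fun p : ℝ × ℝ => φ (β p.1, gridPt ε (spaceIdx ε p.2)) :=
    hφ.measurable.comp ((hβ.comp measurable_fst).prodMk
      ((measurable_gridPt_spaceIdx ε).comp measurable_snd))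
  exact ((measurable_tau.comp measurable_snd).mul h1).mul h2

section

variable {w₀ : ℝ → ℝ} {L : NNReal} {ε A : ℝ} {φ : ℝ × ℝ → ℝ}

theorem integrable_sampledPairing (hε : 0 < ε) (hA : ∀ x, |w₀ x| ≤ A) (hφ : ContDiff ℝ 1 φ)
    (hs : HasCompactSupport φ) {t : ℝ} (ht : 0 ≤ t) (t' : ℝ) :
    Integrable (sampledPairing w₀ ε φ t t') :=
  integrable_tau_mul_comp_spaceIdx hε (abs_timeInterp_le hε hA ht)
    (contDiff_slice_snd hφ t').continuous (hasCompactSupport_slice_snd hs t')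

theorem exists_support_bound (hs : HasCompactSupport φ) :
    ∃ R, 0 ≤ R ∧ ∀ t y, φ (t, y) ≠ 0 → |t| ≤ R ∧ |y| ≤ R := by
  obtain ⟨R, hR⟩ := hs.isBounded.subset_closedBall 0
  refine ⟨max R 0, le_max_right _ _, fun t y h => ?_⟩
  have := hR (subset_tsupport φ h)
  rw [mem_closedBall_zero_iff, Prod.norm_def] at this
  exact ⟨((le_max_left _ _).trans this).trans (le_max_left _ _),
    ((le_max_right _ _).trans this).trans (le_max_left _ _)⟩

theorem integrable_openHalf_sampledPairing (hε : 0 < ε) (hA : ∀ x, |w₀ x| ≤ A)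
    (hφ : ContDiff ℝ 1 φ) (hs : HasCompactSupport φ) (c : ℝ) {d : ℝ} (hd : 0 ≤ d) :
    Integrable (fun p : ℝ × ℝ => sampledPairing w₀ ε φ (p.1 + d) (p.1 + c) p.2)
      (volume.restrict openHalf) := by
  obtain ⟨R, hR0, hR⟩ := exists_support_bound hs
  obtain ⟨D, hD⟩ := hs.exists_bound_of_continuous hφ.continuous
  have h2 : Measurable fun p : ℝ × ℝ => φ (p.1 + c, gridPt ε (spaceIdx ε p.2)) :=
    hφ.continuous.measurable.comp ((measurable_fst.add_const c).prodMk
      ((measurable_gridPt_spaceIdx ε).comp measurable_snd))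
  have h3 : Integrable (fun p : ℝ × ℝ => φ (p.1 + c, gridPt ε (spaceIdx ε p.2)))
      (volume.restrict openHalf) := by
    refine integrable_of_bound_of_support h2 (fun p => hD _)
      (isCompact_Icc.prod isCompact_Icc (s := Icc (-R - c) (R - c))
        (t := Icc (-(R + 2 * ε)) (R + 2 * ε))) fun p hp => ?_
    obtain ⟨h4, h5⟩ := hR _ _ hp
    rw [abs_le] at h4
    exact ⟨⟨by linarith, by linarith⟩, abs_le.1 (abs_le_of_gridPt_mem hε h5)⟩
  have h1 : Measurable fun p : ℝ × ℝ => timeInterp w₀ ε (p.1 + d) (spaceIdx ε p.2) :=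
    (measurable_timeInterp_comp w₀ ε id).comp ((measurable_fst.add_const d).prodMk measurable_snd)
  refine h3.bdd_mul (c := 2 * A)
    ((measurable_tau.comp measurable_snd).mul h1).aestronglyMeasurable
    (ae_restrict_openHalf fun p hp => ?_)
  simp only [norm_mul]
  exact mul_le_mul (abs_tau_le _)
    (abs_timeInterp_le hε hA (add_nonneg (pos_of_mem_openHalf hp).le hd) _) (abs_nonneg _)
    zero_le_two

/-- The exact discrete weak formulation. -/
theorem half_integral_interpDerivY_mul (hL : LipschitzWith L w₀) (hε : 0 < ε)
    (hA : ∀ x, |w₀ x| ≤ A) (hφ : ContDiff ℝ 1 φ) (hs : HasCompactSupport φ) :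
    1 / 2 * ∫ p in openHalf, interpDerivY w₀ ε p * deriv (fun y => φ (p.1, y)) p.2
      = (∫ p in openHalf, (2 * ε ^ 2)⁻¹ * (sampledPairing w₀ ε φ p.1 p.1 p.2
          - sampledPairing w₀ ε φ p.1 (p.1 - 2 * ε ^ 2) p.2))
        + ∫ r in (0 : ℝ)..1, ∫ y,
            sampledPairing w₀ ε φ (2 * ε ^ 2 * r) (2 * ε ^ 2 * r - 2 * ε ^ 2) y := by
  set k := 2 * ε ^ 2 with hk
  have hk0 : 0 < k := by positivity
  set J : ℝ → ℝ → ℝ := fun t t' => ∫ y, sampledPairing w₀ ε φ t t' y with hJ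
  have i0 : Integrable (fun p => interpDerivY w₀ ε p * deriv (fun y => φ (p.1, y)) p.2)
      (volume.restrict openHalf) := by
    simp only [(hasDerivAt_slice_snd hφ _ _).deriv]
    exact (integrable_fderiv_apply hφ hs _).bdd_mul
      (measurable_interpDerivY w₀ ε).aestronglyMeasurable
      (ae_restrict_openHalf fun p hp => abs_interpDerivY_le hL hε (pos_of_mem_openHalf hp).le)
  have i1 := integrable_openHalf_sampledPairing hε hA hφ hs 0 (d := 0) le_rfl
  have i2 := integrable_openHalf_sampledPairing hε hA hφ hs (-k) (d := 0) le_rfl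
  have i3 := integrable_openHalf_sampledPairing hε hA hφ hs 0 hk0.le
  simp only [add_zero, ← sub_eq_add_neg] at i1 i2 i3
  have hleft : 1 / 2 * ∫ p in openHalf, interpDerivY w₀ ε p * deriv (fun y => φ (p.1, y)) p.2
      = ∫ t in Ioi 0, -(k⁻¹ * (J (t + k) t - J t t)) := by
    rw [volume_restrict_openHalf] at i0 ⊢
    rw [integral_prod _ i0, ← integral_const_mul]
    refine setIntegral_congr_fun measurableSet_Ioi fun t ht => ?_
    have ht0 : 0 ≤ t := (mem_Ioi.1 ht).le
    simp only [interpDerivY]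
    rw [half_integral_slope_mul_deriv hε (abs_timeInterp_gap_le hL hε ht0)
      (contDiff_slice_snd hφ t) (hasCompactSupport_slice_snd hs t), hJ]
    simp only
    rw [← integral_sub (integrable_sampledPairing hε hA hφ hs (by linarith) t)
      (integrable_sampledPairing hε hA hφ hs ht0 t)]
    congr 3
    funext y
    simp only [sampledPairing]
    rw [hk, timeInterp_add_timeStep w₀ hε ht0]
    ring
  rw [volume_restrict_openHalf] at i1 i2 i3
  have j1 : IntegrableOn (fun t => J t t) (Ioi 0) := i1.integral_prod_left
  have j2 : IntegrableOn (fun t => J t (t - k)) (Ioi 0) := i2.integral_prod_left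
  have j3 : IntegrableOn (fun t => J (t + k) t) (Ioi 0) := i3.integral_prod_left
  -- Summation by parts in time: the translation moves the difference from the walk to φ, and the
  -- missing interval (0, k) becomes the initial layer.
  have hshift : ∫ t in Ioi 0, J (t + k) t = ∫ t in Ioi k, J t (t - k) := by
    have := (measurePreserving_add_right volume k).setIntegral_preimage_emb
      (measurableEmbedding_addRight k) (fun t => J t (t - k)) (Ioi k)
    simpa using this
  have hsplit : ∫ t in Ioi 0, J t (t - k)
      = (∫ t in (0 : ℝ)..k, J t (t - k)) + ∫ t in Ioi k, J t (t - k) := by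
    rw [intervalIntegral.integral_of_le hk0.le, ← setIntegral_union
      Ioc_disjoint_Ioi_same measurableSet_Ioi (j2.mono_set Ioc_subset_Ioi_self)
      (j2.mono_set (Ioi_subset_Ioi hk0.le)), Ioc_union_Ioi_eq_Ioi hk0.le]
  have hright : ∫ p in openHalf, k⁻¹ * (sampledPairing w₀ ε φ p.1 p.1 p.2
      - sampledPairing w₀ ε φ p.1 (p.1 - k) p.2)
      = k⁻¹ * ((∫ t in Ioi 0, J t t) - ∫ t in Ioi 0, J t (t - k)) := by
    rw [integral_const_mul, volume_restrict_openHalf, integral_sub i1 i2, integral_prod _ i1,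
      integral_prod _ i2]
  have hlayer : ∫ r in (0 : ℝ)..1, J (k * r) (k * r - k)
      = k⁻¹ * ∫ t in (0 : ℝ)..k, J t (t - k) := by
    rw [intervalIntegral.integral_comp_mul_left (fun t => J t (t - k)) hk0.ne', mul_zero, mul_one,
      smul_eq_mul]
  rw [hleft, hright, hlayer, integral_neg, integral_const_mul, integral_sub j3 j1, hshift, hsplit]
  ring

end

/-! ### Passage to the limit. -/

section

variable {w₀ : ℝ → ℝ} {L : NNReal} {A : ℝ} {φ : ℝ × ℝ → ℝ} {e : ℕ → ℝ} {w : ℝ × ℝ → ℝ}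

theorem tendsto_of_abs_sub_le_mul {a : ℕ → ℝ} {b C : ℝ} (he : Tendsto e atTop (𝓝 0))
    (h : ∀ i, |a i - b| ≤ C * e i) : Tendsto a atTop (𝓝 b) := by
  rw [tendsto_iff_dist_tendsto_zero]
  exact squeeze_zero (fun _ => dist_nonneg) h (by simpa using he.const_mul C)

theorem tendsto_timeStep (he : Tendsto e atTop (𝓝 0)) :
    Tendsto (fun i => 2 * e i ^ 2) atTop (𝓝 0) := by
  simpa using (he.pow 2).const_mul 2

theorem tendsto_gridPt_spaceIdx (hpos : ∀ i, 0 < e i) (he : Tendsto e atTop (𝓝 0)) (y : ℝ) :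
    Tendsto (fun i => gridPt (e i) (spaceIdx (e i) y)) atTop (𝓝 y) :=
  tendsto_of_abs_sub_le_mul (C := 2) he fun i => by
    rw [abs_sub_comm]; exact abs_sub_gridPt_le (hpos i) y

theorem tendsto_timeInterp_spaceIdx (hL : LipschitzWith L w₀) (hpos : ∀ i, 0 < e i)
    (he : Tendsto e atTop (𝓝 0)) {p : ℝ × ℝ} (hp : 0 ≤ p.1)
    (hw : Tendsto (fun i => interp w₀ (e i) p) atTop (𝓝 (w p))) :
    Tendsto (fun i => timeInterp w₀ (e i) p.1 (spaceIdx (e i) p.2)) atTop (𝓝 (w p)) := by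
  have h : Tendsto (fun i => interp w₀ (e i) p - timeInterp w₀ (e i) p.1 (spaceIdx (e i) p.2))
      atTop (𝓝 0) := tendsto_of_abs_sub_le_mul (C := 4 * L) he fun i => by
    rw [sub_zero]; exact abs_interp_sub_timeInterp_le hL (hpos i) hp
  simpa using hw.sub h

theorem abs_timeInterp_initial_sub_le (hL : LipschitzWith L w₀) {ε : ℝ} (hε : 0 < ε) {t : ℝ}
    (ht : 0 ≤ t) (ht' : t < 2 * ε ^ 2) (y : ℝ) :
    |timeInterp w₀ ε t (spaceIdx ε y) - w₀ y| ≤ 4 * L * ε := by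
  have hk : (0 : ℝ) < 2 * ε ^ 2 := by positivity
  have h0 : timeIdx ε t = 0 := Nat.floor_eq_zero.2 ((div_lt_one hk).2 ht')
  have h1 := abs_timeInterp_sub_walk_le hL hε ht (spaceIdx ε y)
  rw [h0] at h1
  have h2 := abs_walk_zero_sub_le hL hε (spaceIdx ε y) (Ico_subset_Icc_self (mem_space_cell hε y))
  have h3 := mul_le_mul_of_nonneg_left (cellWidth_le hε (spaceIdx ε y)) L.coe_nonneg
  rw [abs_le] at *
  constructor <;> linarith

theorem interp_zero_tendsto (hL : LipschitzWith L w₀) (hpos : ∀ i, 0 < e i)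
    (he : Tendsto e atTop (𝓝 0)) (y : ℝ) :
    Tendsto (fun i => interp w₀ (e i) (0, y)) atTop (𝓝 (w₀ y)) := by
  refine tendsto_of_abs_sub_le_mul (C := 8 * L) he fun i => ?_
  have h1 := abs_interp_sub_timeInterp_le hL (hpos i) (p := (0, y)) le_rfl
  have h2 := abs_timeInterp_initial_sub_le hL (hpos i) le_rfl
    (by have := hpos i; positivity) y
  rw [abs_le] at *
  constructor <;> linarith

/-- Difference quotients of a `C¹` function in the time direction along moving base points. -/
theorem tendsto_timeQuotient (hφ : ContDiff ℝ 1 φ) {k z : ℕ → ℝ} (hk0 : ∀ i, 0 < k i)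
    (hk : Tendsto k atTop (𝓝 0)) {t y : ℝ} (hz : Tendsto z atTop (𝓝 y)) :
    Tendsto (fun i => (k i)⁻¹ * (φ (t, z i) - φ (t - k i, z i))) atTop
      (𝓝 (fderiv ℝ φ (t, y) (1, 0))) := by
  -- Strict differentiability is needed because both endpoints of the quotient move with `i`.
  have hstrict := (hφ.contDiffAt (x := (t, y))).hasStrictFDerivAt one_ne_zero
  have hlim : Tendsto (fun i => ((t, z i), (t - k i, z i))) atTop (𝓝 ((t, y), (t, y))) := by
    have h1 : Tendsto (fun i => t - k i) atTop (𝓝 t) := by simpa using hk.const_sub t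
    exact (tendsto_const_nhds.prodMk_nhds hz).prodMk_nhds (h1.prodMk_nhds hz)
  have ho := hstrict.isLittleO.comp_tendsto hlim
  rw [tendsto_iff_dist_tendsto_zero]
  have hO := ho.norm_norm.tendsto_div_nhds_zero
  refine hO.congr fun i => ?_
  have hne := (hk0 i).ne'
  simp only [Function.comp_apply, Prod.mk_sub_mk, sub_self, sub_sub_cancel]
  rw [show ((k i, 0) : ℝ × ℝ) = k i • (1, 0) by simp, map_smul, norm_smul, Real.dist_eq,
    Real.norm_eq_abs, Real.norm_eq_abs, abs_of_pos (hk0 i), smul_eq_mul,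
    show ‖((1, 0) : ℝ × ℝ)‖ = 1 by simp [Prod.norm_def], mul_one, div_eq_inv_mul]
  nth_rewrite 1 [← abs_of_pos (inv_pos.2 (hk0 i))]
  rw [← abs_mul]
  congr 1
  field_simp

theorem tendsto_integral_timeQuotient (hL : LipschitzWith L w₀) (hA : ∀ x, |w₀ x| ≤ A)
    (hpos : ∀ i, 0 < e i) (he : Tendsto e atTop (𝓝 0))
    (hw : ∀ p ∈ openHalf, Tendsto (fun i => interp w₀ (e i) p) atTop (𝓝 (w p)))
    (hφ : ContDiff ℝ 1 φ) (hs : HasCompactSupport φ) :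
    Tendsto (fun i => ∫ p in openHalf, (2 * e i ^ 2)⁻¹ * (sampledPairing w₀ (e i) φ p.1 p.1 p.2
          - sampledPairing w₀ (e i) φ p.1 (p.1 - 2 * e i ^ 2) p.2)) atTop
      (𝓝 (∫ p in openHalf, tau p.2 * w p * deriv (fun t => φ (t, p.2)) p.1)) := by
  obtain ⟨R, hR0, hR⟩ := exists_support_bound hs
  obtain ⟨D, hD⟩ := hφ.lipschitzWith_of_hasCompactSupport hs one_ne_zero
  have hA0 : 0 ≤ A := (abs_nonneg _).trans (hA 0)
  -- The margin 1 absorbs the spatial sampling shift, at most 2ε, and the time shift 2ε², once both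
  -- are below 1.
  set S : Set (ℝ × ℝ) := Icc (-(R + 1)) (R + 1) ×ˢ Icc (-(R + 1)) (R + 1) with hS
  have hSc : IsCompact S := isCompact_Icc.prod isCompact_Icc
  have hkpos : ∀ i, 0 < 2 * e i ^ 2 := fun i => by have := hpos i; positivity
  refine tendsto_integral_filter_of_dominated_convergence (S.indicator fun _ => 2 * A * D)
    (Eventually.of_forall fun i => ?_) ?_ ?_ (ae_restrict_openHalf fun p hp => ?_)
  · exact (((measurable_sampledPairing w₀ (e i) hφ.continuous measurable_id measurable_id).sub
      (measurable_sampledPairing w₀ (e i) hφ.continuous measurable_id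
        (measurable_id.sub_const _))).const_mul _).aestronglyMeasurable
  · filter_upwards [(tendsto_timeStep he).eventually_lt_const one_pos,
      he.eventually_lt_const (show (0 : ℝ) < 1 / 2 by norm_num)] with i hi1 hi2
    refine ae_restrict_openHalf fun p hp => ?_
    set z := gridPt (e i) (spaceIdx (e i) p.2) with hz
    have hrw : (2 * e i ^ 2)⁻¹ * (sampledPairing w₀ (e i) φ p.1 p.1 p.2
          - sampledPairing w₀ (e i) φ p.1 (p.1 - 2 * e i ^ 2) p.2)
        = tau p.2 * timeInterp w₀ (e i) p.1 (spaceIdx (e i) p.2)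
          * ((2 * e i ^ 2)⁻¹ * (φ (p.1, z) - φ (p.1 - 2 * e i ^ 2, z))) := by
      simp only [sampledPairing]; ring
    rw [hrw]
    by_cases hpS : p ∈ S
    · rw [indicator_of_mem hpS, norm_mul, norm_mul, norm_mul, norm_inv, Real.norm_eq_abs (2 * _),
        abs_of_pos (hkpos i)]
      have h1 : ‖φ (p.1, z) - φ (p.1 - 2 * e i ^ 2, z)‖ ≤ D * (2 * e i ^ 2) := by
        refine (hD.norm_sub_le _ _).trans_eq ?_
        rw [Prod.mk_sub_mk, sub_self, sub_sub_cancel, Prod.norm_mk, norm_zero,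
          Real.norm_eq_abs, abs_of_pos (hkpos i), max_eq_left (hkpos i).le]
      refine mul_le_mul (mul_le_mul (abs_tau_le _)
        (abs_timeInterp_le (hpos i) hA (pos_of_mem_openHalf hp).le _) (abs_nonneg _) zero_le_two)
        ?_ (by have := hkpos i; positivity) (by positivity)
      rw [inv_mul_le_iff₀ (hkpos i)]
      linarith
    · have hzero : ∀ s, |s - p.1| ≤ 1 → φ (s, z) = 0 := by
        intro s hs1
        by_contra hne
        obtain ⟨h1, h2⟩ := hR _ _ hne
        have h3 := abs_le_of_gridPt_mem (hpos i) h2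
        apply hpS
        rw [abs_le] at h1 h3 hs1
        exact ⟨⟨by linarith, by linarith⟩, ⟨by linarith, by linarith⟩⟩
      rw [hzero p.1 (by simp), hzero (p.1 - 2 * e i ^ 2) (by
        rw [sub_sub_cancel_left, abs_neg, abs_of_pos (hkpos i)]; exact hi1.le)]
      simp [indicator_of_notMem hpS]
  · exact (integrable_indicator_iff hSc.measurableSet).2
      (integrableOn_const hSc.measure_lt_top.ne)
  · have h1 := tendsto_timeInterp_spaceIdx hL hpos he (pos_of_mem_openHalf hp).le (hw p hp)
    have h2 := tendsto_timeQuotient hφ hkpos (tendsto_timeStep he) (t := p.1)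
      (tendsto_gridPt_spaceIdx hpos he p.2)
    rw [(hasDerivAt_slice_fst hφ p.1 p.2).deriv]
    refine ((h1.const_mul (tau p.2)).mul h2).congr fun i => ?_
    simp only [sampledPairing]; ring

theorem tendsto_integral_initialLayer (hL : LipschitzWith L w₀) (hA : ∀ x, |w₀ x| ≤ A)
    (hpos : ∀ i, 0 < e i) (he : Tendsto e atTop (𝓝 0))
    (hφ : ContDiff ℝ 1 φ) (hs : HasCompactSupport φ) :
    Tendsto (fun i => ∫ r in (0 : ℝ)..1, ∫ y,
        sampledPairing w₀ (e i) φ (2 * e i ^ 2 * r) (2 * e i ^ 2 * r - 2 * e i ^ 2) y) atTop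
      (𝓝 (∫ y, tau y * w₀ y * φ (0, y))) := by
  obtain ⟨R, hR0, hR⟩ := exists_support_bound hs
  obtain ⟨D, hD⟩ := hs.exists_bound_of_continuous hφ.continuous
  have hD0 : 0 ≤ D := (norm_nonneg _).trans (hD 0)
  have hA0 : 0 ≤ A := (abs_nonneg _).trans (hA 0)
  have hkpos : ∀ i, 0 < 2 * e i ^ 2 := fun i => by have := hpos i; positivity
  set S : Set ℝ := Icc (-(R + 1)) (R + 1) with hS
  set bd : ℝ → ℝ := S.indicator fun _ => 2 * A * D with hbd
  have hbdi : Integrable bd := (integrable_indicator_iff measurableSet_Icc).2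
    (integrableOn_const isCompact_Icc.measure_lt_top.ne)
  have hmeas : ∀ i, Measurable fun p : ℝ × ℝ =>
      sampledPairing w₀ (e i) φ (2 * e i ^ 2 * p.1) (2 * e i ^ 2 * p.1 - 2 * e i ^ 2) p.2 :=
    fun i => measurable_sampledPairing w₀ (e i) hφ.continuous (measurable_id.const_mul _)
      ((measurable_id.const_mul _).sub_const _)
  have hbound : ∀ᶠ i in atTop, ∀ r, 0 ≤ r → ∀ y,
      ‖sampledPairing w₀ (e i) φ (2 * e i ^ 2 * r) (2 * e i ^ 2 * r - 2 * e i ^ 2) y‖ ≤ bd y := by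
    filter_upwards [he.eventually_lt_const (show (0 : ℝ) < 1 / 2 by norm_num)] with i hi r hr y
    rw [sampledPairing]
    by_cases hy : y ∈ S
    · rw [hbd, indicator_of_mem hy, norm_mul, norm_mul]
      exact mul_le_mul (mul_le_mul (abs_tau_le _)
        (abs_timeInterp_le (hpos i) hA (mul_nonneg (hkpos i).le hr) _) (abs_nonneg _) zero_le_two)
        (hD _) (norm_nonneg _) (by positivity)
    · rw [hbd, indicator_of_notMem hy, norm_le_zero_iff]
      refine mul_eq_zero_of_right _ ?_
      by_contra hne
      have h3 := abs_le_of_gridPt_mem (hpos i) (hR _ _ hne).2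
      apply hy
      rw [abs_le] at h3
      exact ⟨by linarith, by linarith⟩
  -- For r < 1 the time stays in the first time interval, where the walk is O(ε)-close to w₀. The
  -- value r = 1 is excluded, being the start of the next interval, and is a null set.
  have hinner : ∀ r, 0 ≤ r → r < 1 → Tendsto (fun i => ∫ y,
        sampledPairing w₀ (e i) φ (2 * e i ^ 2 * r) (2 * e i ^ 2 * r - 2 * e i ^ 2) y) atTop
      (𝓝 (∫ y, tau y * w₀ y * φ (0, y))) := by
    intro r hr hr1
    refine tendsto_integral_filter_of_dominated_convergence bd (Eventually.of_forall fun i => ?_)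
      ?_ hbdi (ae_of_all _ fun y => ?_)
    · exact ((hmeas i).comp measurable_prodMk_left).aestronglyMeasurable
    · filter_upwards [hbound] with i hi
      exact ae_of_all _ (hi r hr)
    · have h1 : Tendsto (fun i => timeInterp w₀ (e i) (2 * e i ^ 2 * r) (spaceIdx (e i) y)) atTop
          (𝓝 (w₀ y)) := tendsto_of_abs_sub_le_mul (C := 4 * L) he fun i =>
        abs_timeInterp_initial_sub_le hL (hpos i) (mul_nonneg (hkpos i).le hr)
          (mul_lt_of_lt_one_right (hkpos i) hr1) y
      have h2 : Tendsto (fun i => 2 * e i ^ 2 * r - 2 * e i ^ 2) atTop (𝓝 0) := by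
        simpa using ((tendsto_timeStep he).mul_const r).sub (tendsto_timeStep he)
      exact (h1.const_mul (tau y)).mul (hφ.continuous.continuousAt.tendsto.comp
        (h2.prodMk_nhds (tendsto_gridPt_spaceIdx hpos he y)))
  have hone : ∫ _ in (0 : ℝ)..1, (∫ y, tau y * w₀ y * φ (0, y))
      = ∫ y, tau y * w₀ y * φ (0, y) := by simp
  rw [← hone]
  refine intervalIntegral.tendsto_integral_filter_of_dominated_convergence (fun _ => ∫ y, bd y)
    (Eventually.of_forall fun i => ?_) ?_ intervalIntegrable_const ?_
  · exact (hmeas i).stronglyMeasurable.integral_prod_right'.aestronglyMeasurable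
  · filter_upwards [hbound] with i hi
    refine ae_of_all _ fun r hr => ?_
    rw [uIoc_of_le zero_le_one] at hr
    exact norm_integral_le_of_norm_le hbdi (ae_of_all _ (hi r hr.1.le))
  · filter_upwards [compl_mem_ae_iff.2 (measure_singleton (μ := volume) (1 : ℝ))] with r hr1 hr
    rw [uIoc_of_le zero_le_one] at hr
    exact hinner r hr.1.le (lt_of_le_of_ne hr.2 hr1)

end

/-! ### Extension to the plane, the density form, and assembly. -/

/-- The nearest-point projection of the plane onto the closed half-plane. -/
def clamp (p : ℝ × ℝ) : ℝ × ℝ := (max p.1 0, p.2)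

theorem clamp_of_mem {p : ℝ × ℝ} (hp : p ∈ closedHalf) : clamp p = p := by
  rw [clamp, max_eq_left (mem_Ici.1 hp.1)]

theorem dist_clamp_le (p q : ℝ × ℝ) : dist (clamp p) (clamp q) ≤ dist p q :=
  max_le_max (abs_max_sub_max_le_abs p.1 q.1 0) le_rfl

/-- Since τ never vanishes, v/τ is w itself; the same weak derivative serves, and the two integral
identities coincide. -/
theorem isWeakDensitySolution_of_isWeakSolution {w₀ : ℝ → ℝ} {w : ℝ × ℝ → ℝ} {A : ℝ}
    (hw : Measurable w) (hA : ∀ p, |w p| ≤ A) (h : IsWeakSolution w₀ w) :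
    IsWeakDensitySolution (fun x => tau x * w₀ x) (fun p => tau p.2 * w p) := by
  obtain ⟨-, wy, h1, h2, h3⟩ := h
  refine ⟨locallyIntegrableOn_of_bound (A := 2 * A) ((measurable_tau.comp measurable_snd).mul hw)
    measurableSet_closedHalf fun p _ => ?_, wy, ?_, h2, h3⟩
  · rw [abs_mul]
    exact mul_le_mul (abs_tau_le _) (hA p) (abs_nonneg _) zero_le_two
  · convert! h1 using 1
    funext p
    exact mul_div_cancel_left₀ _ (tau_ne_zero _)

end

end SojournWalk

open SojournWalk

theorem theorem2p1 (w₀ : ℝ → ℝ) (hw₀ : ContDiff ℝ (⊤ : ℕ∞) w₀) (hc : HasCompactSupport w₀)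
    (ε : ℕ → ℝ) (hε : ∀ n, 0 < ε n) (hε0 : Tendsto ε atTop (𝓝 0)) :
    ∃ (s : ℕ → ℕ) (w : ℝ × ℝ → ℝ), StrictMono s ∧
      (∃ C, LipschitzOnWith C w SojournWalk.closedHalf) ∧
      (∀ K ⊆ SojournWalk.closedHalf, IsCompact K →
        TendstoUniformlyOn (fun i => SojournWalk.interp w₀ (ε (s i))) w atTop K) ∧
      SojournWalk.DerivYTendstoWeakStar (fun i => SojournWalk.interp w₀ (ε (s i))) w ∧
      SojournWalk.IsWeakSolution w₀ w ∧
      (∀ y, w (0, y) = w₀ y) ∧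
      SojournWalk.IsWeakDensitySolution (fun x => SojournWalk.tau x * w₀ x)
        (fun p => SojournWalk.tau p.2 * w p) := by
  have hd : Differentiable ℝ w₀ := hw₀.differentiable (by simp)
  obtain ⟨L, hL⟩ := hw₀.lipschitzWith_of_hasCompactSupport hc (by simp)
  have hd1 : ContDiff ℝ 1 (deriv w₀) :=
    (contDiff_infty_iff_deriv.1 hw₀).2.of_le (by exact_mod_cast le_top)
  obtain ⟨M, hM⟩ := hd1.lipschitzWith_of_hasCompactSupport hc.deriv one_ne_zero
  obtain ⟨A, hA⟩ := hc.exists_bound_of_continuous hw₀.continuous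
  have hη : Tendsto (fun n => 20 * L * ε n + 4 * M * ε n ^ 2) atTop (𝓝 0) := by
    simpa using (hε0.const_mul (20 * (L : ℝ))).add ((hε0.pow 2).const_mul (4 * (M : ℝ)))
  have hclamp : ∀ p : ℝ × ℝ, 0 ≤ (clamp p).1 := fun p => le_max_right _ _
  -- Composition with `clamp` extends the functions constantly to negative times, so that w is
  -- Lipschitz on the whole plane and its line derivative is bounded everywhere.
  obtain ⟨s, w, hs, hw, hlim⟩ := exists_subseq_tendstoLocallyUniformly_of_dist_le
    (f := fun n p => interp w₀ (ε n) (clamp p)) (A := A) (K := L + M)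
    (fun n p => abs_interp_le (hε n) hA (hclamp p))
    (fun n p q => (abs_interp_sub_interp_le hL hd hM (hε n) (hclamp p) (hclamp q)).trans (by
      have := mul_le_mul_of_nonneg_left (dist_clamp_le p q) (L + M).coe_nonneg
      push_cast at this ⊢
      linarith)) hη
  have hpos : ∀ i, 0 < ε (s i) := fun i => hε _
  have he : Tendsto (fun i => ε (s i)) atTop (𝓝 0) := hε0.comp hs.tendsto_atTop
  have hptc : ∀ p, Tendsto (fun i => interp w₀ (ε (s i)) (clamp p)) atTop (𝓝 (w p)) := fun p =>
    (tendstoLocallyUniformlyOn_univ.2 hlim).tendsto_at (mem_univ p)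
  have hpt : ∀ p ∈ closedHalf, Tendsto (fun i => interp w₀ (ε (s i)) p) atTop (𝓝 (w p)) := by
    intro p hp
    simpa only [clamp_of_mem hp] using hptc p
  have hpt' := fun p hp => hpt p (openHalf_subset_closedHalf hp)
  have hwA : ∀ p, |w p| ≤ A := fun p =>
    le_of_tendsto (hptc p).abs (Eventually.of_forall fun i => abs_interp_le (hε _) hA (hclamp p))
  set G : ℝ × ℝ → ℝ := fun p => lineDeriv ℝ w p (0, 1) with hG
  have hGm : Measurable G := measurable_lineDeriv_snd hw
  have hparts := fun i φ hφ hφs => integral_openHalf_interp_mul_deriv_snd (φ := φ) hL (hpos i) hA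
    hφ hφs
  have hpartsw := fun φ hφ hφs => integral_openHalf_lipschitz_mul_deriv_snd (φ := φ) hw hwA hφ hφs
  have hgC : ∀ i, ∀ p ∈ openHalf, |interpDerivY w₀ (ε (s i)) p| ≤ 2 * L := fun i p hp =>
    abs_interpDerivY_le hL (hpos i) (pos_of_mem_openHalf hp).le
  have hfA : ∀ i, ∀ p ∈ openHalf, |interp w₀ (ε (s i)) p| ≤ A := fun i p hp =>
    abs_interp_le (hpos i) hA (pos_of_mem_openHalf hp).le
  have hwG : HasWeakDerivY w G := hasWeakDerivY_of_bound hw.continuous.measurable hGm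
    (fun p _ => hwA p) (fun p _ => abs_lineDeriv_snd_le hw p) hpartsw
  have hstar : TendstoWeakStar (fun i => interpDerivY w₀ (ε (s i))) G :=
    tendstoWeakStar_of_tendsto (C := max (2 * (L : ℝ)) (L + M : NNReal))
      (fun i => measurable_interp w₀ _) (fun i => measurable_interpDerivY w₀ _) hGm hfA
      (fun i p hp => (hgC i p hp).trans (le_max_left _ _))
      (fun p _ => (abs_lineDeriv_snd_le hw p).trans (le_max_right _ _)) hparts hpartsw hpt'
  have hsol : IsWeakSolution w₀ w := by
    refine ⟨locallyIntegrableOn_of_bound hw.continuous.measurable measurableSet_closedHalf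
      fun p _ => hwA p, G, hwG, locallyIntegrableOn_of_bound hGm measurableSet_closedHalf
      fun p _ => abs_lineDeriv_snd_le hw p, fun φ hφ hφs => ?_⟩
    have h1 := (tendsto_integral_timeQuotient hL hA hpos he hpt' hφ hφs).add
      (tendsto_integral_initialLayer hL hA hpos he hφ hφs)
    -- Both sides of the exact discrete identity converge: the right by the two limits in `h1`, the
    -- left by weak* convergence tested against ∂_yφ, which lies in L¹.
    refine tendsto_nhds_unique h1 ?_
    have hint : MeasureTheory.Integrable (fun p : ℝ × ℝ => deriv (fun y => φ (p.1, y)) p.2)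
        (MeasureTheory.volume.restrict openHalf) := by
      simp only [(hasDerivAt_slice_snd hφ _ _).deriv]
      exact integrable_fderiv_apply hφ hφs _
    refine ((hstar.2.2 _ hint).const_mul (1 / 2)).congr fun i => ?_
    exact half_integral_interpDerivY_mul hL (hpos i) hA hφ hφs
  refine ⟨s, w, hs, ⟨L + M, hw.lipschitzOnWith⟩, fun K hK hKc => ?_,
    ⟨_, G, fun i => hasWeakDerivY_of_bound (measurable_interp w₀ _) (measurable_interpDerivY w₀ _)
      (hfA i) (hgC i) (hparts i), hwG, hstar⟩, hsol, fun y => ?_,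
    isWeakDensitySolution_of_isWeakSolution hw.continuous.measurable hwA hsol⟩
  · refine (tendstoLocallyUniformly_iff_forall_isCompact.1 hlim K hKc).congr
      (Eventually.of_forall fun i p hp => ?_)
    simp only [clamp_of_mem (hK hp)]
  · exact tendsto_nhds_unique (hpt (0, y) ⟨mem_Ici.2 le_rfl, mem_univ _⟩)
      (interp_zero_tendsto hL hpos he y)
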